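/- **Proposition (Segre's theorem in the viscosity sense).** Let $\Omega\subseteq\mathbb{R}^n$ be open, let $u:\Omega\to\mathbb{R}$ be continuous, and let $f,g:u(\Omega)\to\mathbb{R}$ be continuous with $f>0$. Put $\operatorname{sgn}(t)=1$ for $t\ge 0$ and $\operatorname{sgn}(t)=-1$ for $t<0$. Suppose that $u$ is a viscosity solution in $\Omega$ of the system $$\begin{cases}\operatorname{sgn}(g(u))\,\bigl(f(u)-|\nabla u|\bigr)=0,\\ \Delta u-g(u)=0,\end{cases}$$ that is: for every $x_0\in\Omega$ and every function $\varphi$ of class $C^2$ near $x_0$ with $\varphi(x_0)=u(x_0)$, * if $\varphi\le u$ near $x_0$, then $\operatorname{sgn}(g(\varphi(x_0)))\bigl(f(\varphi(x_0))-|\nabla\varphi(x_0)|\bigr)\le 0$ and $\Delta\varphi(x_0)-g(\varphi(x_0))\le 0$; * if $\varphi\ge u$ near $x_0$, then $\operatorname{sgn}(g(\varphi(x_0)))\bigl(f(\varphi(x_0))-|\nabla\varphi(x_0)|\bigr)\ge 0$ and $\Delta\varphi(x_0)-g(\varphi(x_0))\ge 0$. Then $u\in C^2(\Omega)$, and $|\nabla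 u|=f(u)$ and $\Delta u=g(u)$ hold pointwise in $\Omega$. -/

import Mathlib

open Topology

/-- The sign function with the convention `sgn 0 = 1`. -/
noncomputable def visSgn (t : ℝ) : ℝ := if 0 ≤ t then 1 else -1

/-- The Hessian matrix of `φ` at `x`, whose entries are the second order partial derivatives. -/
noncomputable def hessianMatrix {n : ℕ} (φ : EuclideanSpace ℝ (Fin n) → ℝ)
    (x : EuclideanSpace ℝ (Fin n)) : Matrix (Fin n) (Fin n) ℝ :=
  Matrix.of fun i j =>
    iteratedFDeriv ℝ 2 φ x ![EuclideanSpace.single i (1 : ℝ), EuclideanSpace.single j (1 : ℝ)]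

/-- `φ` is a test function (`C²` near `x₀`) touching `u` from below at `x₀`. -/
def TouchesFromBelow {n : ℕ} (φ u : EuclideanSpace ℝ (Fin n) → ℝ)
    (x₀ : EuclideanSpace ℝ (Fin n)) : Prop :=
  ContDiffAt ℝ 2 φ x₀ ∧ φ x₀ = u x₀ ∧ ∀ᶠ x in 𝓝 x₀, φ x ≤ u x

/-- `φ` is a test function (`C²` near `x₀`) touching `u` from above at `x₀`. -/
def TouchesFromAbove {n : ℕ} (φ u : EuclideanSpace ℝ (Fin n) → ℝ)
    (x₀ : EuclideanSpace ℝ (Fin n)) : Prop :=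
  ContDiffAt ℝ 2 φ x₀ ∧ φ x₀ = u x₀ ∧ ∀ᶠ x in 𝓝 x₀, u x ≤ φ x

/-- `u` is a viscosity solution in `Ω` of the equation `F(u, ∇u, D²u) = 0`.
The orientation is the one for operators that are nondecreasing in the Hessian argument, such as
`Δu - g(u)`: test functions touching from below give `F ≤ 0` (supersolution), and test functions
touching from above give `F ≥ 0` (subsolution). `F` need not be continuous and is evaluated as it
stands, without passing to semicontinuous envelopes. -/
structure IsViscositySolution {n : ℕ}
    (F : ℝ → EuclideanSpace ℝ (Fin n) → Matrix (Fin n) (Fin n) ℝ → ℝ)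
    (Ω : Set (EuclideanSpace ℝ (Fin n))) (u : EuclideanSpace ℝ (Fin n) → ℝ) : Prop where
  continuousOn : ContinuousOn u Ω
  supersolution : ∀ x₀ ∈ Ω, ∀ φ : EuclideanSpace ℝ (Fin n) → ℝ, TouchesFromBelow φ u x₀ →
    F (φ x₀) (gradient φ x₀) (hessianMatrix φ x₀) ≤ 0
  subsolution : ∀ x₀ ∈ Ω, ∀ φ : EuclideanSpace ℝ (Fin n) → ℝ, TouchesFromAbove φ u x₀ →
    0 ≤ F (φ x₀) (gradient φ x₀) (hessianMatrix φ x₀)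

/-- `u` is a viscosity solution in `Ω` of the system
`sgn(g(u)) (f(u) - |∇u|) = 0`, `Δu - g(u) = 0`. -/
def IsViscositySolutionOfSystem {n : ℕ} (f g : ℝ → ℝ)
    (Ω : Set (EuclideanSpace ℝ (Fin n))) (u : EuclideanSpace ℝ (Fin n) → ℝ) : Prop :=
  IsViscositySolution (fun r p _ => visSgn (g r) * (f r - ‖p‖)) Ω u ∧
    IsViscositySolution (fun r _ X => X.trace - g r) Ω u

/-!
# Segre's theorem for viscosity solutions

A viscosity solution of `sgn (g u) (f u - |∇u|) = 0`, `Δu = g u` is of class `C²` and solves both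
equations pointwise.

Suppose first that the eikonal equation has its standard orientation, in which gradients of test
functions touching from above have norm at most `f u`. With a primitive `F` of `1 / f` and its
inverse `G`, write `u = G ∘ v`, so that `|∇v| = 1` in the viscosity sense and `G' = h > 0`, but `G`
is not known to be better than `C¹`. Comparison with cones shows that `v` is `1`-Lipschitz and that
every point is the end of a segment along which `v` increases with unit speed
(`IsNormalizedSolution.exists_direction`); hence `v` is touched from above at every point by a
smooth cone with unit gradient.

The second order equation enters through ridges: a function lying below `⟪a, ·⟫ - |⟪b, ·⟫|` up to a
quadratic error has superjets of arbitrarily negative trace unless `b = 0`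
(`eq_zero_of_le_ridge`), which is impossible for `G ∘ v`. So `v` has no local maximum. The levels
slightly above `v x` are therefore attained, and cones with vertices at those levels touch `v` from
below along segments. Viscosity comparison in one variable then bounds `G''` from above
(`IsNormalizedSolution.exists_quadratic_upper_bound`). With this bound, two different second order
supergradients of `v` at a point would again put `G ∘ v` below a ridge, so they are unique and have
norm one. This is the eikonal equation in the reversed orientation, which yields segments in the
forward direction too. Thus `v` is trapped between two cones: it is differentiable with a Lipschitz
unit gradient field `e` that is constant along its own lines
(`IsNormalizedSolution.exists_gradient`, `IsEikonalField.lipschitzOnWith`).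

By Rademacher's theorem `e` is differentiable at almost every point, and then along the whole line
through such a point, where its divergence is an explicit continuous function `H` of the level.
Testing the second order equation along this line and comparing in one variable gives
`h' = k - h H`, with `k = g ∘ G`; in particular `G` is `C²`, and the second order equation forces
the divergence of `e` to be `H ∘ v` wherever `e` is differentiable
(`IsNormalizedSolution.exists_hasDerivAt`). If `q' = -q H` and `P' = q > 0`, the gradient `q (v) e`
of `P ∘ v` is Lipschitz and divergence free almost everywhere, so `P ∘ v` is smooth by Weyl's lemma
(`contDiffAt_of_opTrace_eq_zero`), and `u` is `C²`.

Finally, on the open set where `g u < 0` the orientation of the eikonal equation is reversed, which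
is the standard one for `-u`. So `u` is `C²` there with `|∇u| = f u`, and this makes `u` a solution
with the standard orientation on all of `Ω` (`isOrientedSolution`). Once `u` is known to be `C²`, it
is its own test function, and the equation `Δu = g u` holds pointwise.
-/

namespace SegreViscosity

open Filter Metric Asymptotics Set
open scoped RealInnerProductSpace

/-! ### Superjets, supergradients and traces -/

section Jets

variable {E : Type*} [NormedAddCommGroup E] [InnerProductSpace ℝ E]

/-- The quadratic polynomial `z ↦ c + ⟪p, z - x⟫ + ½ ⟪B (z - x), z - x⟫`. The operator `B` need not
be symmetric. -/
noncomputable def quadPoly (c : ℝ) (p : E) (B : E →L[ℝ] E) (x z : E) : ℝ :=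
  c + ⟪p, z - x⟫ + 1 / 2 * ⟪B (z - x), z - x⟫

/-- `p` is a supergradient of `u` at `x`: some function that is differentiable at `x` with
gradient `p` touches `u` from above at `x`. -/
def IsSupergradientAt [CompleteSpace E] (u : E → ℝ) (p x : E) : Prop :=
  ∃ φ : E → ℝ, HasGradientAt φ p x ∧ φ x = u x ∧ ∀ᶠ z in 𝓝 x, u z ≤ φ z

/-- `(p, B)` is a second order superjet of `u` at `x`: near `x`, the function `u` is at most
`u x + ⟪p, z - x⟫ + ½ ⟪B (z - x), z - x⟫ + o(‖z - x‖²)`. Subjets of `u` are expressed as superjets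
of `-u`. -/
def HasUpperJetAt (u : E → ℝ) (p : E) (B : E →L[ℝ] E) (x : E) : Prop :=
  ∃ φ : E → ℝ, (fun z => φ z - quadPoly (u x) p B x z) =o[𝓝 x] (fun z => ‖z - x‖ ^ 2) ∧
    ∀ᶠ z in 𝓝 x, u z ≤ φ z

theorem quadPoly_self (c : ℝ) (p : E) (B : E →L[ℝ] E) (x : E) : quadPoly c p B x x = c := by
  simp [quadPoly]

theorem quadPoly_smul_id (c K : ℝ) (p x z : E) :
    quadPoly c p (K • ContinuousLinearMap.id ℝ E) x z = c + ⟪p, z - x⟫ + K / 2 * ‖z - x‖ ^ 2 := by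
  simp only [quadPoly, smul_apply, ContinuousLinearMap.id_apply,
    real_inner_smul_left, real_inner_self_eq_norm_sq]
  ring

theorem contDiff_quadPoly (c : ℝ) (p : E) (B : E →L[ℝ] E) (x : E) {m : WithTop ℕ∞} :
    ContDiff ℝ m (quadPoly c p B x) := by
  unfold quadPoly
  have h : ContDiff ℝ m (fun z : E => z - x) := contDiff_id.sub contDiff_const
  exact (contDiff_const.add (contDiff_const.inner ℝ h)).add
    (contDiff_const.mul ((B.contDiff.comp h).inner ℝ h))

theorem hasFDerivAt_quadPoly (c : ℝ) (p : E) (B : E →L[ℝ] E) (x z : E) :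
    HasFDerivAt (quadPoly c p B x) (innerSL ℝ p +
      (1 / 2 : ℝ) • (innerSL ℝ (B (z - x)) + (innerSL ℝ (z - x)).comp B)) z := by
  have h : HasFDerivAt (fun z : E => z - x) (ContinuousLinearMap.id ℝ E) z :=
    (hasFDerivAt_id z).sub_const x
  have h2 : HasFDerivAt (fun z : E => B (z - x)) B z := B.hasFDerivAt.comp z h
  have h3 := (((innerSL ℝ p).hasFDerivAt.comp z h).const_add c).add
    ((h2.inner ℝ h).const_mul (1 / 2 : ℝ))
  refine (h3.congr_fderiv ?_)
  ext v
  simp [real_inner_comm, inner_sub_right]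
  ring

theorem hasGradientAt_quadPoly_self [CompleteSpace E] (c : ℝ) (p : E) (B : E →L[ℝ] E) (x : E) :
    HasGradientAt (quadPoly c p B x) p x := by
  rw [hasGradientAt_iff_hasFDerivAt]
  refine (hasFDerivAt_quadPoly c p B x x).congr_fderiv ?_
  ext v
  simp

theorem hasGradientAt_quadPoly_smul_id [CompleteSpace E] (c K : ℝ) (p x z : E) :
    HasGradientAt (quadPoly c p (K • ContinuousLinearMap.id ℝ E) x) (p + K • (z - x)) z := by
  rw [hasGradientAt_iff_hasFDerivAt]
  refine (hasFDerivAt_quadPoly c p _ x z).congr_fderiv ?_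
  ext v
  simp
  ring

theorem fderiv_fderiv_quadPoly (c : ℝ) (p : E) (B : E →L[ℝ] E) (x z v w : E) :
    fderiv ℝ (fderiv ℝ (quadPoly c p B x)) z v w = 1 / 2 * (⟪B v, w⟫ + ⟪v, B w⟫) := by
  have h1 : fderiv ℝ (quadPoly c p B x) = fun z => innerSL ℝ p +
      (1 / 2 : ℝ) • (innerSL ℝ (B (z - x)) + (innerSL ℝ (z - x)).comp B) :=
    funext fun z => (hasFDerivAt_quadPoly c p B x z).fderiv
  let T : E →L[ℝ] E →L[ℝ] ℝ := (1 / 2 : ℝ) • ((innerSL ℝ).comp B +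
    ((ContinuousLinearMap.compL ℝ E E ℝ).flip B).comp (innerSL ℝ))
  have h2 : HasFDerivAt (fderiv ℝ (quadPoly c p B x)) T z := by
    have h3 : fderiv ℝ (quadPoly c p B x) = fun z => innerSL ℝ p + T (z - x) := by
      rw [h1]
      ext z w
      simp [T]
    rw [h3]
    have h : HasFDerivAt (fun z : E => z - x) (ContinuousLinearMap.id ℝ E) z :=
      (hasFDerivAt_id z).sub_const x
    exact ((T.hasFDerivAt.comp z h).const_add _)
  rw [h2.fderiv]
  simp [T]
  ring

/-- A quadratic upper bound near a point gives a superjet with a scalar second order part. -/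
theorem HasUpperJetAt.of_eventually_le {u : E → ℝ} {p x : E} {B : E →L[ℝ] E}
    (h : ∀ᶠ z in 𝓝 x, u z ≤ quadPoly (u x) p B x z) : HasUpperJetAt u p B x :=
  ⟨quadPoly (u x) p B x, by simp, h⟩

/-- A function that is differentiable and touches `u` from above can be replaced by a paraboloid
touching `u` from above at a nearby point with almost the same gradient. -/
theorem IsSupergradientAt.exists_quadPoly [FiniteDimensional ℝ E] {u : E → ℝ} {p x : E} {U : Set E}
    (hU : U ∈ 𝓝 x) (hu : ContinuousOn u U) (hp : IsSupergradientAt u p x) {ε : ℝ} (hε : 0 < ε) :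
    ∃ y q : E, ∃ ψ : E → ℝ, dist y x < ε ∧ ‖q - p‖ < ε ∧ ContDiff ℝ 2 ψ ∧ HasGradientAt ψ q y ∧
      ψ y = u y ∧ ∀ᶠ z in 𝓝 y, u z ≤ ψ z := by
  obtain ⟨φ, hφ, hφx, hle⟩ := hp
  set η : ℝ := ε / 8 with hη
  have hη0 : 0 < η := by positivity
  have h1 := (hasGradientAt_iff_isLittleO.1 hφ).def hη0
  obtain ⟨ρ₀, hρ₀, hball⟩ := Metric.mem_nhds_iff.1 (Filter.inter_mem (Filter.inter_mem hU h1) hle)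
  set ρ : ℝ := min (ρ₀ / 2) (ε / 2) with hρ
  have hρ0 : 0 < ρ := by positivity
  have hsub : closedBall x ρ ⊆ ball x ρ₀ :=
    closedBall_subset_ball (lt_of_le_of_lt (min_le_left _ _) (by linarith))
  have hb : ∀ z ∈ closedBall x ρ, u z ≤ u x + ⟪p, z - x⟫ + η * ‖z - x‖ := by
    intro z hz
    have hz' := hball (hsub hz)
    have h2 : ‖φ z - φ x - ⟪p, z - x⟫‖ ≤ η * ‖z - x‖ := hz'.1.2
    have h3 : u z ≤ φ z := hz'.2
    have := (abs_le.1 h2).2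
    rw [hφx] at this
    linarith
  set K : ℝ := 4 * η / ρ with hK
  have hKρ : K * ρ = 4 * η := by rw [hK]; field_simp
  have hK0 : 0 < K := by positivity
  set Q : E → ℝ := quadPoly 0 p (K • ContinuousLinearMap.id ℝ E) x with hQ
  have hcont : ContinuousOn (fun z => u z - Q z) (closedBall x ρ) := by
    refine ContinuousOn.sub (hu.mono fun z hz => (hball (hsub hz)).1.1) ?_
    exact (contDiff_quadPoly (m := 2) _ _ _ _).continuous.continuousOn
  -- the paraboloid `Q` is so steep on the sphere that `u - Q` has its maximum in the open ball
  obtain ⟨y, hy, hmax⟩ := (isCompact_closedBall x ρ).exists_isMaxOn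
    ⟨x, mem_closedBall_self hρ0.le⟩ hcont
  have hQv : ∀ z, Q z = ⟪p, z - x⟫ + K / 2 * ‖z - x‖ ^ 2 := by
    intro z; rw [hQ, quadPoly_smul_id]; ring
  have hyx : ‖y - x‖ < ρ := by
    have hle' : ‖y - x‖ ≤ ρ := by simpa [dist_eq_norm] using hy
    refine lt_of_le_of_ne hle' fun heq => ?_
    have h4 := hmax (mem_closedBall_self hρ0.le)
    simp only [mem_ofPred_eq, hQv] at h4
    have h5 := hb y hy
    rw [heq] at h4 h5
    simp at h4
    nlinarith
  refine ⟨y, p + K • (y - x), fun z => Q z + (u y - Q y), ?_, ?_, ?_, ?_, by ring, ?_⟩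
  · rw [dist_eq_norm]
    exact hyx.trans_le ((min_le_right _ _).trans (by linarith))
  · rw [add_sub_cancel_left, norm_smul, Real.norm_of_nonneg hK0.le]
    nlinarith
  · exact (contDiff_quadPoly _ _ _ _).add contDiff_const
  · have := hasGradientAt_quadPoly_smul_id 0 K p x y
    rw [hasGradientAt_iff_hasFDerivAt] at this ⊢
    exact this.add_const _
  · have : closedBall x ρ ∈ 𝓝 y :=
      mem_of_superset (isOpen_ball.mem_nhds (by simpa [dist_eq_norm] using hyx))
        ball_subset_closedBall
    filter_upwards [this] with z hz
    have := hmax hz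
    simp only [mem_ofPred_eq] at this
    linarith

/-- The trace of a continuous linear operator. -/
noncomputable def opTrace (B : E →L[ℝ] E) : ℝ := LinearMap.trace ℝ E (B : E →ₗ[ℝ] E)

theorem opTrace_add (A B : E →L[ℝ] E) : opTrace (A + B) = opTrace A + opTrace B := by
  simp [opTrace]

theorem opTrace_smul (c : ℝ) (A : E →L[ℝ] E) : opTrace (c • A) = c * opTrace A := by
  simp [opTrace]

theorem opTrace_neg (A : E →L[ℝ] E) : opTrace (-A) = -opTrace A := by
  simp [opTrace]

theorem opTrace_id [FiniteDimensional ℝ E] :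
    opTrace (ContinuousLinearMap.id ℝ E) = Module.finrank ℝ E := by
  simp [opTrace]

theorem opTrace_eq_sum [FiniteDimensional ℝ E] {ι : Type*} [Fintype ι]
    (b : OrthonormalBasis ι ℝ E) (A : E →L[ℝ] E) : opTrace A = ∑ i, ⟪b i, A (b i)⟫ := by
  classical
  exact LinearMap.trace_eq_sum_inner (A : E →ₗ[ℝ] E) b

theorem opTrace_toSpanSingleton [FiniteDimensional ℝ E] (e : E) :
    opTrace ((innerSL ℝ e).smulRight e) = ‖e‖ ^ 2 := by
  rw [opTrace_eq_sum (stdOrthonormalBasis ℝ E),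
    ← (stdOrthonormalBasis ℝ E).sum_sq_norm_inner_left e]
  refine Finset.sum_congr rfl fun i _ => ?_
  simp [real_inner_smul_right, real_inner_comm, sq]

theorem continuous_opTrace [FiniteDimensional ℝ E] : Continuous (opTrace (E := E)) := by
  have : (opTrace (E := E)) = fun A => ∑ i, ⟪stdOrthonormalBasis ℝ E i,
      A (stdOrthonormalBasis ℝ E i)⟫ := funext (opTrace_eq_sum _)
  rw [this]
  fun_prop

end Jets

/-! ### Test functions and superjets in Euclidean space -/

section Euclidean

variable {n : ℕ}

theorem trace_hessianMatrix (φ : EuclideanSpace ℝ (Fin n) → ℝ) (x : EuclideanSpace ℝ (Fin n)) :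
    (hessianMatrix φ x).trace = ∑ i, fderiv ℝ (fderiv ℝ φ) x (EuclideanSpace.single i 1)
      (EuclideanSpace.single i 1) := by
  simp [Matrix.trace, hessianMatrix, iteratedFDeriv_two_apply]

theorem trace_hessianMatrix_quadPoly (c : ℝ) (p : EuclideanSpace ℝ (Fin n))
    (B : EuclideanSpace ℝ (Fin n) →L[ℝ] EuclideanSpace ℝ (Fin n))
    (x : EuclideanSpace ℝ (Fin n)) : (hessianMatrix (quadPoly c p B x) x).trace = opTrace B := by
  rw [trace_hessianMatrix, opTrace_eq_sum (EuclideanSpace.basisFun (Fin n) ℝ)]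
  refine Finset.sum_congr rfl fun i _ => ?_
  rw [fderiv_fderiv_quadPoly, EuclideanSpace.basisFun_apply, real_inner_comm]
  ring

/-- A superjet of `u` is, up to an arbitrarily small change of its second order part, the jet of a
test function touching `u` from above; hence bounds on the Hessian traces of test functions pass to
superjets. -/
theorem HasUpperJetAt.le_opTrace {u : EuclideanSpace ℝ (Fin n) → ℝ}
    {p x : EuclideanSpace ℝ (Fin n)}
    {B : EuclideanSpace ℝ (Fin n) →L[ℝ] EuclideanSpace ℝ (Fin n)} {c : ℝ}
    (h : ∀ φ, TouchesFromAbove φ u x → c ≤ (hessianMatrix φ x).trace)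
    (hj : HasUpperJetAt u p B x) : c ≤ opTrace B := by
  obtain ⟨φ, hφ, hle⟩ := hj
  have key : ∀ ε : ℝ, 0 < ε → c ≤ opTrace B + ε * n := by
    intro ε hε
    have h1 := hφ.def (half_pos hε)
    have := h (quadPoly (u x) p (B + ε • ContinuousLinearMap.id ℝ _) x)
      ⟨(contDiff_quadPoly _ _ _ _).contDiffAt, quadPoly_self _ _ _ _, ?_⟩
    · rw [trace_hessianMatrix_quadPoly, opTrace_add, opTrace_smul, opTrace_id] at this
      simpa using this
    · filter_upwards [h1, hle] with z hz1 hz2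
      have h3 : quadPoly (u x) p (B + ε • ContinuousLinearMap.id ℝ _) x z =
          quadPoly (u x) p B x z + ε / 2 * ‖z - x‖ ^ 2 := by
        simp only [quadPoly, add_apply, smul_apply,
          ContinuousLinearMap.id_apply, inner_add_left, real_inner_smul_left,
          real_inner_self_eq_norm_sq]
        ring
      rw [h3]
      rw [Real.norm_of_nonneg (by positivity : (0 : ℝ) ≤ ‖z - x‖ ^ 2)] at hz1
      have := (abs_le.1 hz1).2
      linarith
  refine le_of_forall_pos_le_add fun δ hδ => ?_
  have := key (δ / (n + 1)) (by positivity)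
  refine this.trans ?_
  have : δ / (n + 1) * n ≤ δ := by
    rw [div_mul_eq_mul_div, div_le_iff₀ (by positivity)]
    nlinarith
  linarith

end Euclidean

/-! ### Second order Taylor expansion -/

section Taylor

variable {E : Type*} [NormedAddCommGroup E] [InnerProductSpace ℝ E] [CompleteSpace E]

/-- Second order Taylor expansion of a function whose gradient field is differentiable at `x`. -/
theorem isLittleO_sub_quadPoly {v : E → ℝ} {e : E → E} {A : E →L[ℝ] E} {x : E}
    (hv : ∀ᶠ z in 𝓝 x, HasGradientAt v (e z) z) (he : HasFDerivAt e A x) :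
    (fun z => v z - quadPoly (v x) (e x) A x z) =o[𝓝 x] (fun z => ‖z - x‖ ^ 2) := by
  refine IsLittleO.of_bound fun ε hε => ?_
  have h1 := he.isLittleO.def hε
  obtain ⟨ρ, hρ, hball⟩ := Metric.mem_nhds_iff.1 (Filter.inter_mem hv h1)
  filter_upwards [ball_mem_nhds x hρ] with z hz
  set d := z - x with hd
  have hmem : ∀ τ ∈ Icc (0 : ℝ) 1, x + τ • d ∈ ball x ρ := by
    intro τ hτ
    rw [mem_ball_iff_norm, add_sub_cancel_left, norm_smul, Real.norm_of_nonneg hτ.1]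
    have : ‖d‖ < ρ := by simpa [hd] using mem_ball_iff_norm.1 hz
    nlinarith [norm_nonneg d, hτ.2]
  have hder : ∀ τ ∈ Icc (0 : ℝ) 1, HasDerivWithinAt
      (fun τ : ℝ => v (x + τ • d) - τ * ⟪e x, d⟫ - τ ^ 2 / 2 * ⟪A d, d⟫)
      (⟪e (x + τ • d) - e x - A (τ • d), d⟫) (Icc 0 1) τ := by
    intro τ hτ
    have hg : HasGradientAt v (e (x + τ • d)) (x + τ • d) := (hball (hmem τ hτ)).1
    have hline : HasDerivAt (fun τ : ℝ => x + τ • d) d τ := by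
      simpa using ((hasDerivAt_id τ).smul_const d).const_add x
    have h3 := (hasGradientAt_iff_hasFDerivAt.1 hg).comp_hasDerivAt τ hline
    have h4 := ((h3.sub ((hasDerivAt_id τ).mul_const ⟪e x, d⟫)).sub
      ((((hasDerivAt_id τ).pow 2).div_const 2).mul_const ⟪A d, d⟫))
    refine (HasDerivAt.congr_deriv h4 ?_).hasDerivWithinAt
    simp [inner_sub_left, real_inner_smul_left]
  have hb := norm_image_sub_le_of_norm_deriv_le_segment_01' (C := ε * ‖d‖ ^ 2) hder (by
    intro τ hτ
    have hτ' : τ ∈ Icc (0 : ℝ) 1 := ⟨hτ.1, hτ.2.le⟩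
    have h2 : ‖e (x + τ • d) - e x - A (x + τ • d - x)‖ ≤ ε * ‖x + τ • d - x‖ :=
      (hball (hmem τ hτ')).2
    rw [add_sub_cancel_left] at h2
    refine (norm_inner_le_norm _ _).trans ?_
    have h5 : ‖τ • d‖ ≤ ‖d‖ := by
      rw [norm_smul, Real.norm_of_nonneg hτ'.1]
      nlinarith [norm_nonneg d, hτ'.2]
    calc _ ≤ (ε * ‖d‖) * ‖d‖ := by gcongr; exact h2.trans (by gcongr)
      _ = ε * ‖d‖ ^ 2 := by ring)
  have hxd : x + d = z := by simp [hd]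
  simp only [one_smul, zero_smul, hxd, add_zero] at hb
  rw [Real.norm_of_nonneg (by positivity : (0 : ℝ) ≤ ‖d‖ ^ 2)]
  refine le_of_eq_of_le (congrArg _ ?_) hb
  rw [quadPoly, ← hd]
  ring

end Taylor

/-! ### Chain rule for superjets, and concave ridges -/

section Composition

variable {E : Type*} [NormedAddCommGroup E] [InnerProductSpace ℝ E]

/-- Chain rule for superjets: a nondecreasing function of one variable that is bounded above, to
second order, by `c (t - v x) + b / 2 (t - v x) ^ 2` is composed with a superjet of `v`. -/
theorem HasUpperJetAt.comp_monotone {v : E → ℝ} {G Γ : ℝ → ℝ} {e x : E} {A : E →L[ℝ] E} {c b : ℝ}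
    (hG : Monotone G) (hj : HasUpperJetAt v e A x)
    (hΓ : (fun t => Γ t - (G (v x) + c * (t - v x) + b / 2 * (t - v x) ^ 2)) =o[𝓝 (v x)]
      fun t => (t - v x) ^ 2)
    (hle : ∀ᶠ t in 𝓝 (v x), G t ≤ Γ t) :
    HasUpperJetAt (fun z => G (v z)) (c • e) (c • A + b • (innerSL ℝ e).smulRight e) x := by
  obtain ⟨φ, hφ, hvφ⟩ := hj
  set R : E → ℝ := fun z => φ z - quadPoly (v x) e A x z with hR
  have hsub : Tendsto (fun z : E => z - x) (𝓝 x) (𝓝 0) := by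
    have : Continuous fun z : E => z - x := by fun_prop
    simpa using this.tendsto x
  have hsq : (fun z : E => ‖z - x‖ ^ 2) =o[𝓝 x] (fun z => z - x) := by
    have := (isLittleO_norm_pow_id (E' := E) one_lt_two).comp_tendsto hsub
    simpa [Function.comp_def] using this
  have hin : (fun z : E => ⟪e, z - x⟫) =O[𝓝 x] (fun z => z - x) :=
    (innerSL ℝ e).isBigO_comp (fun z => z - x) (𝓝 x)
  have hq2 : (fun z : E => 1 / 2 * ⟪A (z - x), z - x⟫) =O[𝓝 x] (fun z => ‖z - x‖ ^ 2) := by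
    refine IsBigO.of_bound (‖A‖) (Eventually.of_forall fun z => ?_)
    rw [norm_mul, Real.norm_of_nonneg (by positivity : (0 : ℝ) ≤ ‖z - x‖ ^ 2)]
    have h1 := (norm_inner_le_norm (𝕜 := ℝ) (A (z - x)) (z - x))
    have h2 := A.le_opNorm (z - x)
    have h3 : ‖(1 / 2 : ℝ)‖ = 1 / 2 := by norm_num
    rw [h3]
    nlinarith [norm_nonneg (z - x), norm_nonneg (⟪A (z - x), z - x⟫)]
  -- `φ z - v x` is the linear term up to second order
  have hD : (fun z => φ z - v x - ⟪e, z - x⟫) =O[𝓝 x] (fun z => ‖z - x‖ ^ 2) := by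
    have := hφ.isBigO.add hq2
    refine this.congr_left fun z => ?_
    simp only [hR, quadPoly]
    ring
  have hφ1 : (fun z => φ z - v x) =O[𝓝 x] (fun z => z - x) := by
    have := (hD.trans hsq.isBigO).add hin
    refine this.congr_left fun z => ?_
    ring
  have hφt : Tendsto φ (𝓝 x) (𝓝 (v x)) := by
    have h0 : Tendsto (fun z => φ z - v x) (𝓝 x) (𝓝 0) := hφ1.trans_tendsto hsub
    simpa using h0.add_const (v x)
  have hφsq : (fun z => (φ z - v x) ^ 2) =O[𝓝 x] (fun z => ‖z - x‖ ^ 2) := by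
    simpa using hφ1.norm_right.pow 2
  have hlit1 : (fun z => Γ (φ z) - (G (v x) + c * (φ z - v x) + b / 2 * (φ z - v x) ^ 2)) =o[𝓝 x]
      (fun z => ‖z - x‖ ^ 2) := (hΓ.comp_tendsto hφt).trans_isBigO hφsq
  have hlit2 : (fun z => (φ z - v x) ^ 2 - ⟪e, z - x⟫ ^ 2) =o[𝓝 x] (fun z => ‖z - x‖ ^ 2) := by
    have h1 : (fun z => φ z - v x + ⟪e, z - x⟫) =o[𝓝 x] (fun _ => (1 : ℝ)) := by
      refine IsBigO.trans_isLittleO (hφ1.add hin) ?_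
      exact (isLittleO_one_iff ℝ).2 hsub
    have h2 := hD.mul_isLittleO h1
    simp only [mul_one] at h2
    refine h2.congr_left fun z => ?_
    ring
  refine ⟨fun z => Γ (φ z), ?_, ?_⟩
  · have := (hlit1.add (hφ.const_mul_left c)).add (hlit2.const_mul_left (b / 2))
    refine this.congr_left fun z => ?_
    simp only [hR, quadPoly, add_apply, smul_apply,
      ContinuousLinearMap.smulRight_apply, inner_add_left, real_inner_smul_left,
      innerSL_apply_apply]
    ring
  · filter_upwards [hvφ, hφt.eventually hle] with z h1 h2
    exact (hG h1).trans h2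

/-- The counterpart of `HasUpperJetAt.comp_monotone` for subjets. -/
theorem HasUpperJetAt.neg_comp_monotone {v : E → ℝ} {G Γ : ℝ → ℝ} {e x : E} {A : E →L[ℝ] E}
    {c b : ℝ} (hG : Monotone G) (hj : HasUpperJetAt (fun z => -v z) (-e) (-A) x)
    (hΓ : (fun t => Γ t - (G (v x) + c * (t - v x) + b / 2 * (t - v x) ^ 2)) =o[𝓝 (v x)]
      fun t => (t - v x) ^ 2)
    (hle : ∀ᶠ t in 𝓝 (v x), Γ t ≤ G t) :
    HasUpperJetAt (fun z => -G (v z)) (-(c • e))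
      (-(c • A + b • (innerSL ℝ e).smulRight e)) x := by
  have hneg : Tendsto (fun t : ℝ => -t) (𝓝 (-v x)) (𝓝 (v x)) := by
    simpa using (continuous_neg (G := ℝ)).tendsto (-v x)
  have h := HasUpperJetAt.comp_monotone (G := fun t => -G (-t)) (Γ := fun t => -Γ (-t))
    (v := fun z => -v z) (c := c) (b := -b) (fun s t hst => neg_le_neg (hG (neg_le_neg hst))) hj
    (by
      have := (hΓ.comp_tendsto hneg).neg_left
      refine (this.congr_left fun t => ?_).congr_right fun t => ?_
      · simp only [Function.comp, neg_neg]; ring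
      · simp only [Function.comp]; ring)
    (by filter_upwards [hneg.eventually hle] with t ht using neg_le_neg ht)
  simp only [neg_neg] at h
  convert h using 1
  · simp
  · ext z
    simp
    abel

/-- At a point where `u` lies, up to a quadratic error, below the concave ridge
`c (⟪a, ·⟫ - |⟪b, ·⟫|)`, it has superjets of arbitrarily negative trace unless `b = 0`. -/
theorem eq_zero_of_le_ridge [FiniteDimensional ℝ E] {u : E → ℝ} {x a b : E} {c C κ : ℝ}
    (hc : 0 < c)
    (h : ∀ᶠ z in 𝓝 x, u z ≤ u x + c * (⟪a, z - x⟫ - |⟪b, z - x⟫|) + C * ‖z - x‖ ^ 2)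
    (hκ : ∀ p B, HasUpperJetAt u p B x → κ ≤ opTrace B) : b = 0 := by
  have key : ∀ K : ℝ, 0 < K → κ ≤ 2 * C * Module.finrank ℝ E - 2 * c * K * ‖b‖ ^ 2 := by
    intro K hK
    have hcont : ∀ᶠ z in 𝓝 x, K * |⟪b, z - x⟫| < 1 := by
      have : Continuous fun z : E => K * |⟪b, z - x⟫| := by fun_prop
      exact this.continuousAt.eventually_lt continuousAt_const (by simp)
    have := hκ (c • a) ((2 * C) • ContinuousLinearMap.id ℝ E +
      (-(2 * c * K)) • (innerSL ℝ b).smulRight b) (.of_eventually_le ?_)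
    · rw [opTrace_add, opTrace_smul, opTrace_smul, opTrace_id, opTrace_toSpanSingleton] at this
      linarith
    · filter_upwards [h, hcont] with z hz1 hz2
      refine hz1.trans ?_
      have h3 : K * ⟪b, z - x⟫ ^ 2 ≤ |⟪b, z - x⟫| := by
        rw [← sq_abs]
        nlinarith [abs_nonneg ⟪b, z - x⟫]
      simp only [quadPoly, add_apply, smul_apply, ContinuousLinearMap.id_apply,
        ContinuousLinearMap.smulRight_apply, inner_add_left, real_inner_smul_left,
        innerSL_apply_apply, real_inner_self_eq_norm_sq]
      nlinarith
  by_contra hb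
  have hb' : 0 < ‖b‖ := norm_pos_iff.2 hb
  set D := 2 * c * ‖b‖ ^ 2
  have hD : 0 < D := by positivity
  have := key ((|2 * C * Module.finrank ℝ E - κ| + 1) / D) (by positivity)
  have h2 : 2 * c * ((|2 * C * Module.finrank ℝ E - κ| + 1) / D) * ‖b‖ ^ 2 =
      |2 * C * Module.finrank ℝ E - κ| + 1 := by
    simp only [D]; field_simp
  rw [h2] at this
  linarith [le_abs_self (2 * C * Module.finrank ℝ E - κ)]

end Composition

/-! ### Viscosity comparison in one variable -/

section OneDimensional

/-- One-dimensional viscosity comparison: if `G` is differentiable with derivative `h` and every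
function touching `G` from below has second derivative at most `m` at the contact point, then
`G'' ≤ m` in the sense that `h` minus a primitive of `m` is nonincreasing. -/
theorem antitoneOn_sub_primitive {G h m M₁ : ℝ → ℝ} {α β : ℝ} (hG : ∀ t, HasDerivAt G (h t) t)
    (hM : ∀ t, HasDerivAt M₁ (m t) t)
    (hyp : ∀ s ∈ Ioo α β, ∀ (b : ℝ) (Γ : ℝ → ℝ),
      (fun t => Γ t - (G s + h s * (t - s) + b / 2 * (t - s) ^ 2)) =o[𝓝 s] (fun t => (t - s) ^ 2) →
      (∀ᶠ t in 𝓝 s, Γ t ≤ G t) → b ≤ m s) :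
    AntitoneOn (fun t => h t - M₁ t) (Ioo α β) := by
  have hM₁ : Continuous M₁ := continuous_iff_continuousAt.2 fun t => (hM t).continuousAt
  set M : ℝ → ℝ := fun t => ∫ s in (0 : ℝ)..t, M₁ s with hMdef
  have hM0 : ∀ t, HasDerivAt M (M₁ t) t := fun t =>
    intervalIntegral.integral_hasDerivAt_right (hM₁.intervalIntegrable _ _)
      hM₁.aestronglyMeasurable.stronglyMeasurableAtFilter hM₁.continuousAt
  intro s₁ hs₁ s₂ hs₂ hle
  rcases hle.eq_or_lt with rfl | hlt
  · exact le_rfl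
  by_contra! hcon
  set c₀ := ((h s₁ - M₁ s₁) + (h s₂ - M₁ s₂)) / 2 with hc₀
  -- the tilt `ε` is small enough not to change the signs of the derivative at the end points
  set ε := ((h s₂ - M₁ s₂) - (h s₁ - M₁ s₁)) / (8 * (s₂ - s₁)) with hε
  have hs : 0 < s₂ - s₁ := sub_pos.2 hlt
  have hε0 : 0 < ε := div_pos (by linarith) (by linarith)
  have hεs : ε * (s₂ - s₁) = ((h s₂ - M₁ s₂) - (h s₁ - M₁ s₁)) / 8 := by
    rw [hε]; field_simp
  set W : ℝ → ℝ := fun t => G t - M t - c₀ * t - ε * (t - s₁) ^ 2 with hW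
  have hWd : ∀ t, HasDerivAt W (h t - M₁ t - c₀ - 2 * ε * (t - s₁)) t := by
    intro t
    have h1 := (((hG t).sub (hM0 t)).sub ((hasDerivAt_id t).const_mul c₀)).sub
      ((((hasDerivAt_id t).sub_const s₁).pow 2).const_mul ε)
    refine h1.congr_deriv ?_
    simp
    ring
  -- the minimum of `W` is interior; there `M` plus a quadratic touches `G` from below, with second
  -- derivative `m s + 2 ε`, which is too large
  obtain ⟨s, hsmem, hmin⟩ := isCompact_Icc.exists_isMinOn (nonempty_Icc.2 hle)
    (fun t _ => (hWd t).continuousAt.continuousWithinAt : ContinuousOn W (Icc s₁ s₂))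
  have hne1 : s ≠ s₁ := by
    rintro rfl
    have := hmin.localize.hasFDerivWithinAt_nonneg (hWd s).hasFDerivAt.hasFDerivWithinAt
      (sub_mem_posTangentConeAt_of_segment_subset (y := s₂) (by rw [segment_eq_Icc hle]))
    simp at this
    nlinarith
  have hne2 : s ≠ s₂ := by
    rintro rfl
    have := hmin.localize.hasFDerivWithinAt_nonneg (hWd s).hasFDerivAt.hasFDerivWithinAt
      (sub_mem_posTangentConeAt_of_segment_subset (y := s₁)
        (by rw [segment_symm, segment_eq_Icc hle]))
    simp at this
    nlinarith
  have hsI : s ∈ Ioo s₁ s₂ := ⟨lt_of_le_of_ne hsmem.1 hne1.symm, lt_of_le_of_ne hsmem.2 hne2⟩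
  have hnhds : Icc s₁ s₂ ∈ 𝓝 s := Icc_mem_nhds hsI.1 hsI.2
  have hcrit := (hmin.isLocalMin hnhds).hasDerivAt_eq_zero (hWd s)
  have htaylor := isLittleO_sub_quadPoly (v := M) (e := M₁) (x := s)
    (Eventually.of_forall fun t => (hM0 t).hasGradientAt') (hM s).hasFDerivAt
  have := hyp s ⟨hs₁.1.trans hsI.1, hsI.2.trans hs₂.2⟩ (m s + 2 * ε)
    (fun t => G s + (M t - M s) + c₀ * (t - s) + ε * ((t - s₁) ^ 2 - (s - s₁) ^ 2)) ?_ ?_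
  · linarith
  · refine (htaylor.congr_left fun t => ?_).congr_right fun t => ?_
    · have hhs : h s = M₁ s + c₀ + 2 * ε * (s - s₁) := by linarith
      simp only [quadPoly, hhs]
      simp
      ring
    · simp
  · filter_upwards [hnhds] with t ht
    have := hmin ht
    simp only [mem_ofPred_eq, hW] at this
    linarith

end OneDimensional

/-! ### Comparison with cones -/

section Eikonal

variable {E : Type*} [NormedAddCommGroup E] [InnerProductSpace ℝ E]

/-- The norm lies below its second order expansion at `x ≠ y`. -/
theorem norm_sub_le_expansion {x y : E} {d : ℝ} (hd : 0 < d) (hxy : ‖x - y‖ = d) (z : E) :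
    ‖z - y‖ ≤ d + ⟪d⁻¹ • (x - y), z - x⟫ + ‖z - x‖ ^ 2 / (2 * d) := by
  have h2 : ‖z - y‖ ^ 2 = d ^ 2 + 2 * ⟪x - y, z - x⟫ + ‖z - x‖ ^ 2 := by
    rw [← hxy, ← norm_add_sq_real]; congr 2; abel
  have h4 : d + ⟪d⁻¹ • (x - y), z - x⟫ + ‖z - x‖ ^ 2 / (2 * d) =
      (2 * d ^ 2 + 2 * ⟪x - y, z - x⟫ + ‖z - x‖ ^ 2) / (2 * d) := by
    rw [real_inner_smul_left]; field_simp
  rw [h4, le_div_iff₀ (by positivity)]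
  nlinarith [sq_nonneg (‖z - y‖ - d)]

variable [FiniteDimensional ℝ E]

theorem hasGradientAt_comp_norm_sub {ρ : ℝ → ℝ} {ρ' : ℝ} {x y : E} (hxy : y ≠ x)
    (hρ : HasDerivAt ρ ρ' ‖y - x‖) :
    HasGradientAt (fun z => ρ ‖z - x‖) ((ρ' / ‖y - x‖) • (y - x)) y := by
  have hne : y - x ≠ 0 := sub_ne_zero.2 hxy
  have hpos : 0 < ‖y - x‖ := norm_pos_iff.2 hne
  have h1 : HasFDerivAt (fun z : E => z - x) (ContinuousLinearMap.id ℝ E) y :=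
    (hasFDerivAt_id y).sub_const x
  have h2 := (h1.norm_sq).sqrt (by positivity : ‖y - x‖ ^ 2 ≠ 0)
  have h3 : HasFDerivAt (fun z : E => ‖z - x‖) _ y :=
    h2.congr_of_eventuallyEq (Eventually.of_forall fun z => by simp)
  rw [hasGradientAt_iff_hasFDerivAt]
  refine (hρ.comp_hasFDerivAt y h3).congr_fderiv ?_
  ext v
  simp
  field_simp

/-- A continuous function on a ball all of whose supergradients have norm at most one grows at most
with unit speed from the centre. It is compared with the radial barriers
`(1 + ε) t + K (t / r) ^ m`, whose slope exceeds one and which, for large `m`, are large only near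
the boundary. -/
theorem le_add_norm_of_supergradient_norm_le {w : E → ℝ} {x : E} {r : ℝ} (hr : 0 < r)
    (hw : ContinuousOn w (closedBall x r))
    (h : ∀ y ∈ ball x r, ∀ p, IsSupergradientAt w p y → ‖p‖ ≤ 1) {z : E} (hz : z ∈ ball x r) :
    w z ≤ w x + ‖z - x‖ := by
  obtain ⟨M, hM⟩ := (isCompact_closedBall x r).exists_bound_of_continuousOn hw
  have hxm : x ∈ closedBall x r := mem_closedBall_self hr.le
  have hM0 : 0 ≤ M := (norm_nonneg _).trans (hM x hxm)
  have key : ∀ ε : ℝ, 0 < ε → ∀ m : ℕ, w z ≤ w x + ((1 + ε) * ‖z - x‖ +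
      (2 * M + 1) * (‖z - x‖ / r) ^ (m + 1)) := by
    intro ε hε m
    set ρ : ℝ → ℝ := fun t => (1 + ε) * t + (2 * M + 1) * (t / r) ^ (m + 1) with hρ
    have hρd : ∀ t, HasDerivAt ρ
        ((1 + ε) + (2 * M + 1) * ((m + 1) * (t / r) ^ m * (1 / r))) t := by
      intro t
      have := ((hasDerivAt_id t).const_mul (1 + ε)).add
        ((((hasDerivAt_id t).div_const r).pow (m + 1)).const_mul (2 * M + 1))
      refine this.congr_deriv ?_
      simp
    have hρc : Continuous ρ := by fun_prop
    obtain ⟨y, hy, hmax⟩ := (isCompact_closedBall x r).exists_isMaxOn ⟨x, hxm⟩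
      (hw.sub (hρc.comp (by fun_prop : Continuous fun z : E => ‖z - x‖)).continuousOn)
    simp only [Function.comp_def] at hmax
    have h0 : ρ 0 = 0 := by simp [hρ]
    by_cases hyx : y = x
    · have := hmax (ball_subset_closedBall hz)
      simp only [mem_ofPred_eq, Pi.sub_apply, hyx, sub_self, norm_zero, h0] at this
      simp only [hρ] at this
      linarith
    · exfalso
      have hyr : ‖y - x‖ ≤ r := by simpa [dist_eq_norm] using hy
      have hyr' : ‖y - x‖ < r := by
        refine lt_of_le_of_ne hyr fun heq => ?_
        have h1 := hmax hxm
        simp only [mem_ofPred_eq, Pi.sub_apply, sub_self, norm_zero, h0, heq] at h1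
        simp only [hρ, div_self hr.ne', one_pow] at h1
        have h2 := (abs_le.1 (hM x hxm)).1
        have h3 := (abs_le.1 (hM y hy)).2
        nlinarith
      have hyb : y ∈ ball x r := by simpa [dist_eq_norm] using hyr'
      have hg := hasGradientAt_comp_norm_sub hyx (hρd ‖y - x‖)
      have hpos : 0 < ‖y - x‖ := norm_pos_iff.2 (sub_ne_zero.2 hyx)
      have := h y hyb _ ⟨fun z => ρ ‖z - x‖ + (w y - ρ ‖y - x‖),
        (hasGradientAt_iff_hasFDerivAt.2 ((hasGradientAt_iff_hasFDerivAt.1 hg).add_const _)),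
        add_sub_cancel _ _, ?_⟩
      · rw [norm_smul, norm_div, norm_norm, div_mul_cancel₀ _ hpos.ne',
          Real.norm_of_nonneg (by positivity)] at this
        have h5 : 0 ≤ (2 * M + 1) * ((m + 1) * (‖y - x‖ / r) ^ m * (1 / r)) := by positivity
        linarith
      · filter_upwards [isOpen_ball.mem_nhds hyb] with z hz
        have := hmax (ball_subset_closedBall hz)
        simp only [mem_ofPred_eq, Pi.sub_apply] at this
        linarith
  have hzr : ‖z - x‖ < r := by simpa [dist_eq_norm] using hz
  have hq : ‖z - x‖ / r < 1 := (div_lt_one hr).2 hzr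
  have hlim : ∀ ε : ℝ, 0 < ε → w z ≤ w x + (1 + ε) * ‖z - x‖ := by
    intro ε hε
    have h1 : Tendsto (fun m : ℕ => w x + ((1 + ε) * ‖z - x‖ +
        (2 * M + 1) * (‖z - x‖ / r) ^ (m + 1))) atTop
        (𝓝 (w x + ((1 + ε) * ‖z - x‖ + (2 * M + 1) * 0))) :=
      (((tendsto_pow_atTop_nhds_zero_of_lt_one (by positivity) hq).comp
        (tendsto_add_atTop_nat 1)).const_mul _).const_add _ |>.const_add _
    simpa using ge_of_tendsto' h1 (key ε hε)
  refine le_of_forall_pos_le_add fun δ hδ => ?_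
  have := hlim (δ / r) (by positivity)
  have h2 : δ / r * ‖z - x‖ ≤ δ := by
    rw [div_mul_eq_mul_div, div_le_iff₀ hr]; nlinarith
  linarith

/-- If all (second order) subgradients of `w` in a ball have norm at least one, then `w` drops by at
least the radius from the centre to some point of the sphere. The comparison functions are
smoothed cones of slope less than one. -/
theorem exists_sphere_le_of_one_le_norm {w : E → ℝ} {x : E} {r : ℝ} (hr : 0 < r)
    (hw : ContinuousOn w (closedBall x r))
    (h : ∀ y ∈ ball x r, ∀ (q : E) (K : ℝ),
      (∀ᶠ z in 𝓝 y, w y + ⟪q, z - y⟫ - K * ‖z - y‖ ^ 2 ≤ w z) → 1 ≤ ‖q‖) :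
    ∃ y, ‖y - x‖ = r ∧ w y + r ≤ w x := by
  by_contra! hcon
  -- a slope `θ < 1` and a margin `δ > 0` by which `w` stays above the cone of slope `θ`
  obtain ⟨θ, hθ0, hθ1, δ, hδ, hsph⟩ : ∃ θ : ℝ, 0 ≤ θ ∧ θ < 1 ∧ ∃ δ : ℝ, 0 < δ ∧
      ∀ y, ‖y - x‖ = r → w x - θ * r + δ ≤ w y := by
    rcases (sphere x r).eq_empty_or_nonempty with he | hne
    · refine ⟨0, le_rfl, one_pos, 1, one_pos, fun y hy => ?_⟩
      have : y ∈ sphere x r := by simpa [dist_eq_norm] using hy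
      rw [he] at this
      exact this.elim
    · obtain ⟨y₀, hy₀, hmin⟩ := (isCompact_sphere x r).exists_isMinOn hne
        (hw.mono sphere_subset_closedBall)
      have hy₀' : ‖y₀ - x‖ = r := by simpa [dist_eq_norm] using hy₀
      have h1 := hcon y₀ hy₀'
      set γ := min (w y₀ + r - w x) r with hγ
      have hγ0 : 0 < γ := lt_min (by linarith) hr
      have hγr : γ ≤ r := min_le_right _ _
      have hγ1 : γ ≤ w y₀ + r - w x := min_le_left _ _
      refine ⟨1 - γ / (2 * r), ?_, ?_, γ / 2, by positivity, fun y hy => ?_⟩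
      · rw [sub_nonneg, div_le_one (by positivity)]; linarith
      · have : 0 < γ / (2 * r) := by positivity
        linarith
      · have h2 : w y₀ ≤ w y := hmin (by simpa [dist_eq_norm] using hy)
        have h3 : (1 - γ / (2 * r)) * r = r - γ / 2 := by field_simp
        rw [h3]; linarith
  set ε := δ / 2 with hε
  have hε0 : 0 < ε := by positivity
  set S : E → ℝ := fun z => √(ε ^ 2 + ‖z - x‖ ^ 2) with hS
  have hSc : Continuous S := by fun_prop
  have hS0 : ∀ z, 0 < S z := fun z => Real.sqrt_pos.2 (by positivity)
  have hSsq : ∀ z, S z ^ 2 = ε ^ 2 + ‖z - x‖ ^ 2 := fun z => Real.sq_sqrt (by positivity)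
  obtain ⟨y, hy, hmin⟩ := (isCompact_closedBall x r).exists_isMinOn
    ⟨x, mem_closedBall_self hr.le⟩ (hw.add (hSc.const_smul θ).continuousOn)
  have hyr : ‖y - x‖ ≤ r := by simpa [dist_eq_norm] using hy
  have hSy : ‖y - x‖ ≤ S y := by
    rw [← Real.sqrt_sq (norm_nonneg (y - x))]
    exact Real.sqrt_le_sqrt (by nlinarith)
  have hyr' : ‖y - x‖ < r := by
    refine lt_of_le_of_ne hyr fun heq => ?_
    have h1 := hmin (mem_closedBall_self hr.le)
    have hSx : S x = ε := by simp [hS, Real.sqrt_sq hε0.le]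
    simp only [mem_ofPred_eq, Pi.add_apply, Pi.smul_apply, smul_eq_mul, hSx] at h1
    have h2 := hsph y heq
    rw [heq] at hSy
    nlinarith
  have hyb : y ∈ ball x r := by simpa [dist_eq_norm] using hyr'
  have := h y hyb (-(θ / S y) • (y - x)) (θ / (2 * S y)) ?_
  · rw [norm_smul, norm_neg, norm_div, Real.norm_of_nonneg hθ0, Real.norm_of_nonneg (hS0 y).le,
      div_mul_eq_mul_div, le_div_iff₀ (hS0 y)] at this
    nlinarith [hS0 y]
  · filter_upwards [isOpen_ball.mem_nhds hyb] with z hz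
    have h1 := hmin (ball_subset_closedBall hz)
    simp only [mem_ofPred_eq, Pi.add_apply, Pi.smul_apply, smul_eq_mul] at h1
    have h2 : ‖z - x‖ ^ 2 = ‖y - x‖ ^ 2 + 2 * ⟪y - x, z - y⟫ + ‖z - y‖ ^ 2 := by
      rw [← norm_add_sq_real]; congr 2; abel
    -- the square root lies below its tangent
    have h3 : S z ≤ S y + ⟪y - x, z - y⟫ / S y + ‖z - y‖ ^ 2 / (2 * S y) := by
      have h4 : S y + ⟪y - x, z - y⟫ / S y + ‖z - y‖ ^ 2 / (2 * S y) =
          (2 * S y ^ 2 + 2 * ⟪y - x, z - y⟫ + ‖z - y‖ ^ 2) / (2 * S y) := by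
        have := (hS0 y).ne'
        field_simp
      rw [h4, le_div_iff₀ (by have := hS0 y; positivity)]
      nlinarith [sq_nonneg (S z - S y), hSsq y, hSsq z]
    rw [real_inner_smul_left]
    have h5 : θ * S z ≤ θ * (S y + ⟪y - x, z - y⟫ / S y + ‖z - y‖ ^ 2 / (2 * S y)) := by gcongr
    have h6 : θ * (S y + ⟪y - x, z - y⟫ / S y + ‖z - y‖ ^ 2 / (2 * S y)) =
      θ * S y + θ / S y * ⟪y - x, z - y⟫ + θ / (2 * S y) * ‖z - y‖ ^ 2 := by ring
    linarith

end Eikonal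

/-! ### The gradient of a normalized solution -/

section Structure

variable {E : Type*} [NormedAddCommGroup E] [InnerProductSpace ℝ E]

/-- The minimum of two affine functions with gradients `a` and `b` that agree at `x` is a concave
ridge with mean gradient `(a + b) / 2`. -/
theorem ridge_le {a b x z : E} {C s : ℝ}
    (h1 : s ≤ ⟪a, z - x⟫ + C * ‖z - x‖ ^ 2) (h2 : s ≤ ⟪b, z - x⟫ + C * ‖z - x‖ ^ 2) :
    s ≤ ⟪(1 / 2 : ℝ) • (a + b), z - x⟫ - |⟪(1 / 2 : ℝ) • (a - b), z - x⟫| + C * ‖z - x‖ ^ 2 := by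
  simp only [real_inner_smul_left, inner_add_left, inner_sub_left]
  rcases abs_cases (1 / 2 * (⟪a, z - x⟫ - ⟪b, z - x⟫)) with ⟨h, _⟩ | ⟨h, _⟩ <;> rw [h] <;> linarith

variable [FiniteDimensional ℝ E]

/-- The situation after the change of variables `u = G ∘ v` that normalizes the eikonal equation:
on the ball `ball x₀ R`, the function `v` is a viscosity solution of `|∇v| = 1`, expressed through
supergradients, and `G ∘ v` is a viscosity solution of `Δ (G ∘ v) = k (v)`, expressed through second
order jets. The function `G` is only assumed to be of class `C¹`, with derivative `h > 0`. -/
structure IsNormalizedSolution (G h k : ℝ → ℝ) (v : E → ℝ) (x₀ : E) (R : ℝ) : Prop where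
  hasDerivAt : ∀ t, HasDerivAt G (h t) t
  continuous_h : Continuous h
  h_pos : ∀ t, 0 < h t
  continuous_k : Continuous k
  continuousOn : ContinuousOn v (ball x₀ R)
  supergradient : ∀ x ∈ ball x₀ R, ∀ p, IsSupergradientAt v p x → ‖p‖ ≤ 1
  subgradient : ∀ x ∈ ball x₀ R, ∀ p, IsSupergradientAt (fun z => -v z) p x → 1 ≤ ‖p‖
  upperJet : ∀ x ∈ ball x₀ R, ∀ p B, HasUpperJetAt (fun z => G (v z)) p B x → k (v x) ≤ opTrace B
  lowerJet : ∀ x ∈ ball x₀ R, ∀ p B, HasUpperJetAt (fun z => -G (v z)) p B x →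
    -k (v x) ≤ opTrace B

theorem isSupergradientAt_of_eventually_le {v : E → ℝ} {p x : E} {K : ℝ}
    (h : ∀ᶠ z in 𝓝 x, v z ≤ v x + ⟪p, z - x⟫ + K * ‖z - x‖ ^ 2) : IsSupergradientAt v p x := by
  refine ⟨quadPoly (v x) p ((2 * K) • ContinuousLinearMap.id ℝ E) x,
    hasGradientAt_quadPoly_self _ _ _ _, quadPoly_self _ _ _ _, ?_⟩
  filter_upwards [h] with z hz
  rw [quadPoly_smul_id]
  linarith

variable {G h k : ℝ → ℝ} {v : E → ℝ} {x₀ : E} {r : ℝ}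

namespace IsNormalizedSolution

theorem strictMono {R : ℝ} (S : IsNormalizedSolution G h k v x₀ R) : StrictMono G :=
  strictMono_of_hasDerivAt_pos S.hasDerivAt S.h_pos

/-- `v` is `1`-Lipschitz near the centre. The comparison takes place in balls of radius `8 r` around
the points of `ball x₀ (4 * r)`, which is why the equations are needed in a ball of radius `12 r`. -/
theorem sub_le_norm (S : IsNormalizedSolution G h k v x₀ (12 * r)) (hr : 0 < r) {x y : E}
    (hx : x ∈ ball x₀ (4 * r)) (hy : y ∈ ball x₀ (4 * r)) : v y ≤ v x + ‖y - x‖ := by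
  have hx' := mem_ball.1 hx
  have hsub : closedBall x (8 * r) ⊆ ball x₀ (12 * r) := by
    refine closedBall_subset_ball' ?_
    linarith
  refine le_add_norm_of_supergradient_norm_le (r := 8 * r) (by positivity)
    (S.continuousOn.mono hsub)
    (fun z hz p hp => S.supergradient z (hsub (ball_subset_closedBall hz)) p hp) ?_
  rw [mem_ball] at hy ⊢
  have := dist_triangle_right y x x₀
  linarith

/-- `v` drops by `r` on the way from `x` to some point at distance `r`, because subgradients of `v` have
norm at least one. -/
theorem exists_backward (S : IsNormalizedSolution G h k v x₀ (12 * r)) (hr : 0 < r) {x : E}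
    (hx : x ∈ ball x₀ (3 * r)) : ∃ y, ‖y - x‖ = r ∧ v y + r ≤ v x := by
  have hx' := mem_ball.1 hx
  have hsub : closedBall x r ⊆ ball x₀ (12 * r) := closedBall_subset_ball' (by linarith)
  refine exists_sphere_le_of_one_le_norm hr (S.continuousOn.mono hsub) fun y hy q K hq => ?_
  have := S.subgradient y (hsub (ball_subset_closedBall hy)) (-q)
    (isSupergradientAt_of_eventually_le (K := K) ?_)
  · simpa using this
  · filter_upwards [hq] with z hz
    rw [inner_neg_left]
    linarith

/-- Every point is the end point of a segment of length `r` along which `v` increases with unit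
speed; the cone centred at the other end point bounds `v` from above. -/
theorem exists_direction (S : IsNormalizedSolution G h k v x₀ (12 * r)) (hr : 0 < r) {x : E}
    (hx : x ∈ ball x₀ (3 * r)) : ∃ e : E, ‖e‖ = 1 ∧ (∀ t ∈ Icc 0 r, v (x - t • e) = v x - t) ∧
      ∀ z ∈ ball x₀ (4 * r), v z ≤ v x + ⟪e, z - x⟫ + 1 / (2 * r) * ‖z - x‖ ^ 2 := by
  obtain ⟨y, hyx, hvy⟩ := S.exists_backward hr hx
  have hx' := mem_ball.1 hx
  have hmem : ∀ z, ‖z - x‖ ≤ r → z ∈ ball x₀ (4 * r) := by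
    intro z hz
    rw [← dist_eq_norm] at hz
    rw [mem_ball]
    have := dist_triangle z x x₀
    linarith
  have hx4 : x ∈ ball x₀ (4 * r) := hmem x (by simpa using hr.le)
  have hy4 := hmem y hyx.le
  have hxy : ‖x - y‖ = r := by rw [norm_sub_rev, hyx]
  have hy_eq : x - r • r⁻¹ • (x - y) = y := by rw [smul_inv_smul₀ hr.ne']; abel
  refine ⟨r⁻¹ • (x - y), ?_, fun t ht => ?_, fun z hz => ?_⟩
  · rw [norm_smul, hxy, norm_inv, Real.norm_of_nonneg hr.le, inv_mul_cancel₀ hr.ne']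
  · set e := r⁻¹ • (x - y) with he
    have hen : ‖e‖ = 1 := by
      rw [he, norm_smul, hxy, norm_inv, Real.norm_of_nonneg hr.le, inv_mul_cancel₀ hr.ne']
    have hn : ‖x - (x - t • e)‖ = t := by
      rw [sub_sub_cancel, norm_smul, hen, Real.norm_of_nonneg ht.1, mul_one]
    have hm := hmem (x - t • e) (by rw [norm_sub_rev, hn]; exact ht.2)
    have h1 := S.sub_le_norm hr hm hx4
    rw [hn] at h1
    have h2 := S.sub_le_norm hr hy4 hm
    have h3 : x - t • e - y = (r - t) • e := by
      rw [← hy_eq]; module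
    rw [h3, norm_smul, hen, Real.norm_of_nonneg (sub_nonneg.2 ht.2), mul_one] at h2
    linarith
  · have h1 := S.sub_le_norm hr hy4 hz
    have h2 := norm_sub_le_expansion hr hxy z
    have h3 : 1 / (2 * r) * ‖z - x‖ ^ 2 = ‖z - x‖ ^ 2 / (2 * r) := by ring
    linarith

/-- At a local maximum `v` would lie below the ridge formed by a backward cone and a constant, and
`G`, having positive derivative, preserves ridges below their top value. -/
theorem not_isLocalMax (S : IsNormalizedSolution G h k v x₀ (12 * r)) (hr : 0 < r) {x : E}
    (hx : x ∈ ball x₀ (3 * r)) : ¬ IsLocalMax v x := by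
  intro hmax
  obtain ⟨e, he, -, hcone⟩ := S.exists_direction hr hx
  have hx4 : x ∈ ball x₀ (4 * r) := ball_subset_ball (by linarith) hx
  have hx12 : x ∈ ball x₀ (12 * r) := ball_subset_ball (by linarith) hx
  have hpos := S.h_pos (v x)
  have hvc : ContinuousAt v x := S.continuousOn.continuousAt (isOpen_ball.mem_nhds hx12)
  -- on the left of `v x`, the graph of `G` lies below a line of half the slope
  have hG : ∀ᶠ t in 𝓝 (v x), t ≤ v x → G t ≤ G (v x) + h (v x) / 2 * (t - v x) := by
    have := (S.hasDerivAt (v x)).isLittleO.def (half_pos hpos)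
    filter_upwards [this] with t ht htv
    rw [Real.norm_eq_abs, Real.norm_eq_abs, abs_of_nonpos (sub_nonpos.2 htv)] at ht
    have := (abs_le.1 ht).2
    simp only [smul_eq_mul] at this
    linarith
  have hzero := eq_zero_of_le_ridge (u := fun z => G (v z)) (x := x) (a := (1 / 2 : ℝ) • (e + 0))
    (b := (1 / 2 : ℝ) • (e - 0)) (c := h (v x) / 2) (C := h (v x) / 2 * (1 / (2 * r)))
    (κ := k (v x)) (half_pos hpos) ?_ (fun p B hB => S.upperJet x hx12 p B hB)
  · have : ‖(1 / 2 : ℝ) • (e - 0)‖ = 1 / 2 := by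
      rw [sub_zero, norm_smul, he]; norm_num
    rw [hzero] at this
    norm_num at this
  · filter_upwards [hvc.eventually hG, hmax, isOpen_ball.mem_nhds hx4] with z hz1 hz2 hz3
    have h1 := hcone z hz3
    have h4 : (0 : ℝ) ≤ 1 / (2 * r) * ‖z - x‖ ^ 2 := by positivity
    have h2 := ridge_le (a := e) (b := 0) (x := x) (z := z) (C := 1 / (2 * r)) (s := v z - v x)
      (by linarith) (by simp only [inner_zero_left]; linarith [hz2])
    refine (hz1 hz2).trans ?_
    have h3 := mul_le_mul_of_nonneg_left h2 (half_pos hpos).le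
    linarith

/-- At every level attained near `x₀`, the function `G` is bounded above by its tangent up to a
quadratic error. Levels slightly above `v x` are attained because `x` is not a local maximum; the
points of a segment running back from such a level are touched from below by smooth cones, and the
second order equation then bounds `G''` from above. -/
theorem exists_quadratic_upper_bound (S : IsNormalizedSolution G h k v x₀ (12 * r)) (hr : 0 < r)
    {x : E} (hx : x ∈ ball x₀ (2 * r)) :
    ∃ C, ∀ᶠ t in 𝓝 (v x), G t ≤ G (v x) + h (v x) * (t - v x) + C * (t - v x) ^ 2 := by
  have hx12 : x ∈ ball x₀ (12 * r) := ball_subset_ball (by linarith) hx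
  have hx3 : x ∈ ball x₀ (3 * r) := ball_subset_ball (by linarith) hx
  have hvc : ContinuousAt v x := S.continuousOn.continuousAt (isOpen_ball.mem_nhds hx12)
  have hfreq : ∃ᶠ z in 𝓝 x, v x < v z := by
    have := S.not_isLocalMax hr hx3
    simpa [IsLocalMax, IsMaxFilter, Filter.not_eventually] using this
  obtain ⟨x', hlt, hnear, hx'3⟩ := (hfreq.and_eventually ((hvc.eventually
    (gt_mem_nhds (show v x < v x + r / 2 by linarith))).and (isOpen_ball.mem_nhds hx3))).exists
  obtain ⟨e, he, hline, -⟩ := S.exists_direction hr hx'3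
  have hx'4 : x' ∈ ball x₀ (4 * r) := ball_subset_ball (by linarith) hx'3
  set η := (v x' - v x) / 2 with hη
  have hη0 : 0 < η := by linarith
  -- cones with vertex at least `η` away have second derivatives of size at most `1 / η`
  obtain ⟨M, hM⟩ := isCompact_Icc.exists_bound_of_continuousOn (s := Icc (v x - r / 4) (v x + η))
    (f := fun σ => k σ + Module.finrank ℝ E * h σ / η)
    ((S.continuous_k.add ((continuous_const.mul S.continuous_h).div_const _)).continuousOn)
  have hanti := antitoneOn_sub_primitive (G := G) (h := h) (m := fun _ => M) (M₁ := fun t => M * t)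
    (α := v x - r / 4) (β := v x + η) S.hasDerivAt
    (fun t => by simpa using (hasDerivAt_id t).const_mul M) (by
      intro σ hσ b Γ hΓ hle
      set d := v x' - σ with hd
      have hd1 : η ≤ d := by have := hσ.2; linarith
      have hd0 : 0 < d := hη0.trans_le hd1
      have hd2 : d ≤ r := by have := hσ.1; linarith
      set y := x' - d • e with hy
      have hvy : v y = σ := by rw [hy, hline d ⟨hd0.le, hd2⟩]; linarith
      have hyx' : ‖y - x'‖ = d := by
        rw [hy, sub_sub_cancel_left, norm_neg, norm_smul, he, Real.norm_of_nonneg hd0.le, mul_one]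
      have hy4 : y ∈ ball x₀ (4 * r) := by
        have h1 := mem_ball.1 hx'3
        rw [mem_ball]
        rw [← dist_eq_norm] at hyx'
        have := dist_triangle y x' x₀
        linarith
      have hy12 : y ∈ ball x₀ (12 * r) := ball_subset_ball (by linarith) hy4
      have hyd : d⁻¹ • (y - x') = -e := by
        rw [hy, sub_sub_cancel_left, smul_neg, inv_smul_smul₀ hd0.ne']
      -- the cone with vertex `x'` touches `v` from below at `y`
      have hjet : HasUpperJetAt (fun z => -v z) (-e)
          (-((-(1 / η)) • ContinuousLinearMap.id ℝ E)) y := by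
        refine .of_eventually_le ?_
        filter_upwards [isOpen_ball.mem_nhds hy4] with z hz
        rw [neg_smul, neg_neg, quadPoly_smul_id]
        have h1 := S.sub_le_norm hr hz hx'4
        rw [norm_sub_rev] at h1
        have h2 := norm_sub_le_expansion hd0 hyx' z
        rw [hyd] at h2
        have h3 : ‖z - y‖ ^ 2 / (2 * d) ≤ 1 / η / 2 * ‖z - y‖ ^ 2 := by
          have : 1 / η / 2 * ‖z - y‖ ^ 2 = ‖z - y‖ ^ 2 / (2 * η) := by field_simp
          rw [this]
          gcongr
        linarith
      have hj2 := HasUpperJetAt.neg_comp_monotone (G := G) (Γ := Γ) (c := h σ) (b := b)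
        S.strictMono.monotone hjet (by rw [hvy]; exact hΓ) (by rw [hvy]; exact hle)
      have h4 := S.lowerJet y hy12 _ _ hj2
      rw [hvy, opTrace_neg, opTrace_add, opTrace_smul, opTrace_smul, opTrace_smul, opTrace_id,
        opTrace_toSpanSingleton, he] at h4
      have h5 := (abs_le.1 (hM σ ⟨hσ.1.le, hσ.2.le⟩)).2
      have h6 : h σ * (-(1 / η) * Module.finrank ℝ E) = -(Module.finrank ℝ E * h σ / η) := by ring
      rw [h6] at h4
      linarith)
  refine ⟨M, ?_⟩
  have hI : Ioo (v x - r / 4) (v x + η) ∈ 𝓝 (v x) := Ioo_mem_nhds (by linarith) (by linarith)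
  have hvx : v x ∈ Ioo (v x - r / 4) (v x + η) := mem_of_mem_nhds hI
  filter_upwards [hI] with t ht
  have hGc : Continuous G := continuous_iff_continuousAt.2 fun t => (S.hasDerivAt t).continuousAt
  have hM0 : 0 ≤ M := (norm_nonneg _).trans (hM _ (Ioo_subset_Icc_self hvx))
  rcases lt_trichotomy t (v x) with hlt' | heq | hgt
  · obtain ⟨ξ, hξ, hmv⟩ := exists_hasDerivAt_eq_slope G h hlt' hGc.continuousOn
      fun s _ => S.hasDerivAt s
    rw [eq_div_iff (sub_pos.2 hlt').ne'] at hmv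
    have := hanti ⟨ht.1.trans hξ.1, hξ.2.trans hvx.2⟩ hvx hξ.2.le
    simp only at this
    nlinarith [hξ.1, hξ.2, mul_nonneg hM0 (mul_nonneg (sub_nonneg.2 hlt'.le)
      (sub_nonneg.2 hξ.1.le)), mul_nonneg (sub_nonneg.2 hlt'.le) (sub_nonneg.2 this)]
  · simp [heq]
  · obtain ⟨ξ, hξ, hmv⟩ := exists_hasDerivAt_eq_slope G h hgt hGc.continuousOn
      fun s _ => S.hasDerivAt s
    rw [eq_div_iff (sub_pos.2 hgt).ne'] at hmv
    have := hanti hvx ⟨hvx.1.trans hξ.1, hξ.2.trans ht.2⟩ hξ.1.le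
    simp only at this
    nlinarith [hξ.1, hξ.2, mul_nonneg hM0 (mul_nonneg (sub_nonneg.2 hgt.le)
      (sub_nonneg.2 hξ.2.le)), mul_nonneg (sub_nonneg.2 hgt.le) (sub_nonneg.2 this)]

/-- Second order supergradients of `v` are unique: two different ones would put `G ∘ v` below a
concave ridge. -/
theorem supergradient_unique (S : IsNormalizedSolution G h k v x₀ (12 * r)) (hr : 0 < r)
    {x p q : E} (hx : x ∈ ball x₀ (2 * r)) {K K' : ℝ}
    (hp : ∀ᶠ z in 𝓝 x, v z ≤ v x + ⟪p, z - x⟫ + K * ‖z - x‖ ^ 2)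
    (hq : ∀ᶠ z in 𝓝 x, v z ≤ v x + ⟪q, z - x⟫ + K' * ‖z - x‖ ^ 2) : p = q := by
  have hx12 : x ∈ ball x₀ (12 * r) := ball_subset_ball (by linarith) hx
  obtain ⟨C, hC⟩ := S.exists_quadratic_upper_bound hr hx
  have hpos := S.h_pos (v x)
  set a : E := (1 / 2 : ℝ) • (p + q)
  set b : E := (1 / 2 : ℝ) • (p - q) with hb
  set D := max K K'
  -- `v` lies below the ridge `v x + T`, and `G` maps this ridge below another ridge
  set T : E → ℝ := fun z => ⟪a, z - x⟫ - |⟪b, z - x⟫| + D * ‖z - x‖ ^ 2 with hT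
  have hTc : ContinuousAt (fun z => v x + T z) x := by
    have : Continuous fun z => v x + T z := by fun_prop
    exact this.continuousAt
  have hT0 : v x + T x = v x := by simp [hT]
  have hTev : ∀ᶠ z in 𝓝 x, G (v x + T z) ≤
      G (v x) + h (v x) * T z + C * T z ^ 2 := by
    have h1 : Tendsto (fun z => v x + T z) (𝓝 x) (𝓝 (v x)) := by
      have := hTc.tendsto
      rwa [hT0] at this
    filter_upwards [h1.eventually hC] with z hz
    simpa using hz
  have hball : ∀ᶠ z in 𝓝 x, ‖z - x‖ < 1 := by
    filter_upwards [ball_mem_nhds x one_pos] with z hz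
    simpa [dist_eq_norm] using hz
  have hzero := eq_zero_of_le_ridge (u := fun z => G (v z)) (x := x) (a := a) (b := b)
    (c := h (v x)) (C := h (v x) * D + |C| * (‖a‖ + ‖b‖ + |D|) ^ 2)
    (κ := k (v x)) hpos ?_ (fun p B hB => S.upperJet x hx12 p B hB)
  · have : p - q = 0 := by
      rw [hb] at hzero
      simpa using hzero
    exact sub_eq_zero.1 this
  · filter_upwards [hTev, hball, hp, hq] with z hz1 hz2 hz3 hz4
    have hsq : 0 ≤ ‖z - x‖ ^ 2 := by positivity
    have h1 : K * ‖z - x‖ ^ 2 ≤ D * ‖z - x‖ ^ 2 :=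
      mul_le_mul_of_nonneg_right (le_max_left _ _) hsq
    have h2 : K' * ‖z - x‖ ^ 2 ≤ D * ‖z - x‖ ^ 2 :=
      mul_le_mul_of_nonneg_right (le_max_right _ _) hsq
    have h3 := ridge_le (a := p) (b := q) (x := x) (z := z) (C := D) (s := v z - v x)
      (by linarith) (by linarith)
    have h4 : v z ≤ v x + T z := by simp only [hT]; linarith
    have h5 : |T z| ≤ (‖a‖ + ‖b‖ + |D|) * ‖z - x‖ := by
      have i1 := abs_real_inner_le_norm a (z - x)
      have i2 := abs_real_inner_le_norm b (z - x)
      have i3 : |D * ‖z - x‖ ^ 2| ≤ |D| * ‖z - x‖ := by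
        rw [abs_mul, abs_of_nonneg hsq]
        have : ‖z - x‖ ^ 2 ≤ ‖z - x‖ := by nlinarith [norm_nonneg (z - x)]
        gcongr
      calc |T z| ≤ |(⟪a, z - x⟫ - |⟪b, z - x⟫|)| + |D * ‖z - x‖ ^ 2| := abs_add_le _ _
        _ ≤ |⟪a, z - x⟫| + |⟪b, z - x⟫| + |D * ‖z - x‖ ^ 2| := by
            gcongr
            refine (abs_sub _ _).trans ?_
            rw [abs_abs]
        _ ≤ ‖a‖ * ‖z - x‖ + ‖b‖ * ‖z - x‖ + |D| * ‖z - x‖ := by gcongr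
        _ = _ := by ring
    have h6 : C * T z ^ 2 ≤ |C| * (‖a‖ + ‖b‖ + |D|) ^ 2 * ‖z - x‖ ^ 2 := by
      have j1 : T z ^ 2 ≤ ((‖a‖ + ‖b‖ + |D|) * ‖z - x‖) ^ 2 := by
        rw [← sq_abs]
        gcongr
      calc C * T z ^ 2 ≤ |C| * T z ^ 2 := by gcongr; exact le_abs_self C
        _ ≤ |C| * ((‖a‖ + ‖b‖ + |D|) * ‖z - x‖) ^ 2 := by gcongr
        _ = _ := by ring
    have h7 := (S.strictMono.monotone h4).trans hz1
    refine h7.trans ?_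
    have h8 : h (v x) * T z = h (v x) * (⟪a, z - x⟫ - |⟪b, z - x⟫|) +
        h (v x) * D * ‖z - x‖ ^ 2 := by simp only [hT]; ring
    rw [h8]
    linarith

/-- `v` grows by `r` on the way from `x` to some point at distance `r`. This follows from the eikonal
equation for `-v` in its reversed orientation: a second order supergradient of `v` is unique, so it
is the unit vector given by the backward cone. -/
theorem exists_forward (S : IsNormalizedSolution G h k v x₀ (12 * r)) (hr : 0 < r) {x : E}
    (hx : x ∈ ball x₀ r) : ∃ y, ‖y - x‖ = r ∧ v x + r ≤ v y := by
  have hx' := mem_ball.1 hx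
  have hsub : closedBall x r ⊆ ball x₀ (2 * r) := closedBall_subset_ball' (by linarith)
  have hsub2 : ball x₀ (2 * r) ⊆ ball x₀ (12 * r) := ball_subset_ball (by linarith)
  obtain ⟨y, hy1, hy2⟩ := exists_sphere_le_of_one_le_norm (w := fun z => -v z) hr
    ((S.continuousOn.mono (hsub.trans hsub2)).neg) (by
      intro y hy q K hq
      have hy2 := hsub (ball_subset_closedBall hy)
      obtain ⟨e, he, -, hcone⟩ := S.exists_direction hr (ball_subset_ball (by linarith) hy2)
      have hy4 : y ∈ ball x₀ (4 * r) := ball_subset_ball (by linarith) hy2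
      have : -q = e := S.supergradient_unique hr hy2 (K := K) (K' := 1 / (2 * r)) (by
        filter_upwards [hq] with z hz
        rw [inner_neg_left]
        linarith) (by
        filter_upwards [isOpen_ball.mem_nhds hy4] with z hz using hcone z hz)
      rw [← norm_neg, this, he])
  exact ⟨y, hy1, by linarith⟩

/-- Near the centre, `v` is differentiable with a unit gradient and a uniform quadratic error, and
it grows with unit speed along its gradient in both directions. -/
theorem exists_gradient (S : IsNormalizedSolution G h k v x₀ (12 * r)) (hr : 0 < r) {x : E}
    (hx : x ∈ ball x₀ r) : ∃ e : E, ‖e‖ = 1 ∧ (∀ t ∈ Icc (-r) r, v (x + t • e) = v x + t) ∧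
      ∀ z ∈ ball x₀ (4 * r), |v z - v x - ⟪e, z - x⟫| ≤ 1 / (2 * r) * ‖z - x‖ ^ 2 := by
  have hx3 : x ∈ ball x₀ (3 * r) := ball_subset_ball (by linarith) hx
  have hx2 : x ∈ ball x₀ (2 * r) := ball_subset_ball (by linarith) hx
  have hx4 : x ∈ ball x₀ (4 * r) := ball_subset_ball (by linarith) hx
  have hx' := mem_ball.1 hx
  obtain ⟨e, he, hback, hup⟩ := S.exists_direction hr hx3
  obtain ⟨y, hyx, hvy⟩ := S.exists_forward hr hx
  have hmem : ∀ z, ‖z - x‖ ≤ r → z ∈ ball x₀ (4 * r) := by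
    intro z hz
    rw [← dist_eq_norm] at hz
    rw [mem_ball]
    have := dist_triangle z x x₀
    linarith
  have hy4 := hmem y hyx.le
  have hxy : ‖x - y‖ = r := by rw [norm_sub_rev, hyx]
  set e' : E := r⁻¹ • (y - x) with he'
  have hye' : x + r • e' = y := by rw [he', smul_inv_smul₀ hr.ne']; abel
  have he'n : ‖e'‖ = 1 := by
    rw [he', norm_smul, hyx, norm_inv, Real.norm_of_nonneg hr.le, inv_mul_cancel₀ hr.ne']
  have hlow : ∀ z ∈ ball x₀ (4 * r), v x + ⟪e', z - x⟫ - 1 / (2 * r) * ‖z - x‖ ^ 2 ≤ v z := by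
    intro z hz
    have h1 := S.sub_le_norm hr hz hy4
    rw [norm_sub_rev] at h1
    have h2 := norm_sub_le_expansion hr hxy z
    have h3 : r⁻¹ • (x - y) = -e' := by rw [he', ← smul_neg]; congr 1; abel
    rw [h3, inner_neg_left] at h2
    have h4 : 1 / (2 * r) * ‖z - x‖ ^ 2 = ‖z - x‖ ^ 2 / (2 * r) := by ring
    linarith
  -- both expansions hold on the same segment, so their linear parts agree
  have hee' : e' = e := by
    have h1 := hlow (x - r • e) (hmem _ (by simp [norm_smul, he, abs_of_pos hr]))
    rw [hback r ⟨hr.le, le_rfl⟩] at h1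
    have h2 := hup y hy4
    have h3 : y - x = r • e' := by rw [← hye']; abel
    rw [h3, norm_smul, he'n, real_inner_smul_right, Real.norm_of_nonneg hr.le] at h2
    have h4 : 1 / (2 * r) * (r * 1) ^ 2 = r / 2 := by field_simp
    have hall : ∀ t ∈ Ioc (0 : ℝ) r, 1 - ⟪e', e⟫ ≤ 1 / r * t := by
      intro t ht
      have hn : ‖x - t • e - x‖ = t := by
        simp [norm_smul, he, abs_of_pos ht.1]
      have h5 := hlow (x - t • e) (hmem _ (by rw [hn]; exact ht.2))
      rw [hback t ⟨ht.1.le, ht.2⟩, hn, sub_sub_cancel_left, inner_neg_right,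
        real_inner_smul_right] at h5
      have h6 : t * (1 - ⟪e', e⟫) ≤ t * (1 / r * t) := by
        have : 1 / (2 * r) * t ^ 2 = t * (1 / r * t) / 2 := by field_simp
        have : 0 ≤ t * (1 / r * t) := by have := ht.1; positivity
        linarith
      exact le_of_mul_le_mul_left h6 ht.1
    have hle : 1 - ⟪e', e⟫ ≤ 0 := by
      refine le_of_forall_pos_le_add fun δ hδ => ?_
      have := hall (min r (δ * r)) ⟨lt_min hr (by positivity), min_le_left _ _⟩
      refine this.trans ?_
      have h7 : 1 / r * min r (δ * r) ≤ 1 / r * (δ * r) := by gcongr; exact min_le_right _ _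
      have h8 : 1 / r * (δ * r) = δ := by field_simp
      linarith
    have hge : ⟪e', e⟫ ≤ 1 := by
      have := real_inner_le_norm e' e
      rwa [he, he'n, one_mul] at this
    exact (inner_eq_one_iff_of_norm_eq_one he'n he).1 (le_antisymm hge (by linarith))
  rw [hee'] at hlow hye'
  refine ⟨e, he, fun t ht => ?_, fun z hz => ?_⟩
  · rcases le_total t 0 with h0 | h0
    · have := hback (-t) ⟨by linarith, by linarith [ht.1]⟩
      simpa using this
    · have hn : ‖x + t • e - x‖ = t := by simp [norm_smul, he, abs_of_nonneg h0]
      have hm := hmem (x + t • e) (by rw [hn]; exact ht.2)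
      have h1 := S.sub_le_norm hr hx4 hm
      rw [hn] at h1
      have h2 := S.sub_le_norm hr hm hy4
      have h3 : y - (x + t • e) = (r - t) • e := by rw [← hye']; module
      rw [h3, norm_smul, he, Real.norm_of_nonneg (sub_nonneg.2 ht.2), mul_one] at h2
      linarith
  · rw [abs_le]
    constructor <;> linarith [hlow z hz, hup z hz]

end IsNormalizedSolution

end Structure

/-! ### Unit gradient fields with straight integral curves -/

section Field

variable {E : Type*} [NormedAddCommGroup E] [InnerProductSpace ℝ E]

/-- On `ball x₀ r`, the function `v` has the unit gradient field `e` with a uniform quadratic error,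
and it grows with unit speed along the straight lines in the directions of `e`. -/
structure IsEikonalField (v : E → ℝ) (e : E → E) (x₀ : E) (r : ℝ) : Prop where
  norm_eq : ∀ x ∈ ball x₀ r, ‖e x‖ = 1
  line : ∀ x ∈ ball x₀ r, ∀ t ∈ Icc (-r) r, v (x + t • e x) = v x + t
  expansion : ∀ x ∈ ball x₀ r, ∀ z ∈ ball x₀ r,
    |v z - v x - ⟪e x, z - x⟫| ≤ 1 / (2 * r) * ‖z - x‖ ^ 2

variable {v : E → ℝ} {e : E → E} {x₀ : E} {r : ℝ}

theorem add_smul_mem_ball {x : E} {a s ρ : ℝ} {w : E} (hx : x ∈ ball x₀ a) (hw : ‖w‖ = 1)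
    (h : a + |s| ≤ ρ) : x + s • w ∈ ball x₀ ρ := by
  rw [mem_ball, dist_eq_norm] at hx ⊢
  have : x + s • w - x₀ = (x - x₀) + s • w := by abel
  rw [this]
  have h2 := norm_add_le (x - x₀) (s • w)
  rw [norm_smul, hw, mul_one, Real.norm_eq_abs] at h2
  linarith

namespace IsEikonalField

theorem hasGradientAt [CompleteSpace E] (F : IsEikonalField v e x₀ r) {x : E}
    (hx : x ∈ ball x₀ r) : HasGradientAt v (e x) x := by
  rw [hasGradientAt_iff_isLittleO]
  have hsub : Tendsto (fun z : E => z - x) (𝓝 x) (𝓝 0) := by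
    have : Continuous fun z : E => z - x := by fun_prop
    simpa using this.tendsto x
  have hsq : (fun z : E => ‖z - x‖ ^ 2) =o[𝓝 x] (fun z => z - x) := by
    have := (isLittleO_norm_pow_id (E' := E) one_lt_two).comp_tendsto hsub
    simpa [Function.comp_def] using this
  refine IsBigO.trans_isLittleO (IsBigO.of_bound (1 / (2 * r)) ?_) hsq
  filter_upwards [isOpen_ball.mem_nhds hx] with z hz
  rw [Real.norm_of_nonneg (by positivity : (0 : ℝ) ≤ ‖z - x‖ ^ 2)]
  exact F.expansion x hx z hz

/-- A uniform quadratic error in the first order expansion makes the gradient Lipschitz. -/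
theorem lipschitzOnWith (F : IsEikonalField v e x₀ r) (hr : 0 < r) :
    LipschitzOnWith (Real.toNNReal (3 / r)) e (ball x₀ (r / 4)) := by
  refine LipschitzOnWith.of_dist_le_mul fun y hy x hx => ?_
  rw [Real.coe_toNNReal _ (by positivity), dist_eq_norm, dist_eq_norm]
  rcases eq_or_ne (e y) (e x) with heq | hne
  · rw [heq, sub_self, norm_zero]; positivity
  have hD : 0 < ‖e y - e x‖ := norm_pos_iff.2 (sub_ne_zero.2 hne)
  rcases eq_or_ne y x with rfl | hyx
  · exact absurd rfl hne
  have hd : 0 < ‖y - x‖ := norm_pos_iff.2 (sub_ne_zero.2 hyx)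
  set D := ‖e y - e x‖ with hDdef
  set d := ‖y - x‖ with hddef
  set w : E := D⁻¹ • (e y - e x) with hw
  have hwn : ‖w‖ = 1 := by
    rw [hw, norm_smul, norm_inv, norm_norm, inv_mul_cancel₀ hD.ne']
  have hd2 : d < r / 2 := by
    have h1 := mem_ball.1 hx
    have h2 := mem_ball.1 hy
    have h3 := dist_triangle_right y x x₀
    rw [dist_eq_norm] at h3
    linarith
  -- test the expansions at `x` and `y` in the direction where the gradients differ most
  have hz := add_smul_mem_ball (s := d) (ρ := r) hy hwn (by rw [abs_of_pos hd]; linarith)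
  have hx' : x ∈ ball x₀ r := ball_subset_ball (by linarith) hx
  have hy' : y ∈ ball x₀ r := ball_subset_ball (by linarith) hy
  set z := y + d • w with hzdef
  have h1 := (abs_le.1 (F.expansion x hx' z hz)).2
  have h2 := (abs_le.1 (F.expansion y hy' z hz)).1
  have h3 := (abs_le.1 (F.expansion x hx' y hy')).1
  have hzy : z - y = d • w := by simp [hzdef]
  have hzx : z - x = (y - x) + d • w := by rw [hzdef]; abel
  have hnzy : ‖z - y‖ = d := by rw [hzy, norm_smul, hwn, mul_one, Real.norm_of_nonneg hd.le]
  have hnzx : ‖z - x‖ ≤ 2 * d := by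
    rw [hzx]
    refine (norm_add_le _ _).trans ?_
    rw [norm_smul, hwn, mul_one, Real.norm_of_nonneg hd.le]
    linarith
  have hin : ⟪e y, w⟫ - ⟪e x, w⟫ = D := by
    rw [← inner_sub_left, hw, real_inner_smul_right, real_inner_self_eq_norm_sq, ← hDdef]
    field_simp
  rw [hnzy] at h2
  rw [hzy, real_inner_smul_right] at h2
  rw [hzx, inner_add_right, real_inner_smul_right, ← hzx] at h1
  have hc : 0 < 1 / (2 * r) := by positivity
  have h4 : 1 / (2 * r) * ‖z - x‖ ^ 2 ≤ 1 / (2 * r) * (2 * d) ^ 2 := by gcongr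
  have h5 : d * D ≤ 1 / (2 * r) * (6 * d ^ 2) := by
    rw [← hin]
    nlinarith
  have h6 : 1 / (2 * r) * (6 * d ^ 2) = d * (3 / r * d) := by field_simp; ring
  rw [h6] at h5
  exact le_of_mul_le_mul_left h5 hd

/-- The gradient is constant along the lines in its own direction. -/
theorem apply_add_smul [CompleteSpace E] (F : IsEikonalField v e x₀ r) {x : E} {s : ℝ}
    (hx : x ∈ ball x₀ (r / 2)) (hs : |s| < r / 2) : e (x + s • e x) = e x := by
  have hr : 0 < r := by linarith [abs_nonneg s]
  have hx' : x ∈ ball x₀ r := ball_subset_ball (by linarith) hx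
  have he := F.norm_eq x hx'
  have hy : x + s • e x ∈ ball x₀ r := add_smul_mem_ball hx he (by linarith)
  have hline : HasDerivAt (fun t : ℝ => x + t • e x) (e x) s := by
    simpa using ((hasDerivAt_id s).smul_const (e x)).const_add x
  have h1 := (hasGradientAt_iff_hasFDerivAt.1 (F.hasGradientAt hy)).comp_hasDerivAt s hline
  have h2 : HasDerivAt (fun t : ℝ => v x + t) 1 s := by
    simpa using (hasDerivAt_id s).const_add (v x)
  have h3 : (v ∘ fun t : ℝ => x + t • e x) =ᶠ[𝓝 s] fun t => v x + t := by
    have hs' := abs_lt.1 hs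
    filter_upwards [Ioo_mem_nhds (show -r < s by linarith) (show s < r by linarith)] with t ht
    exact F.line x hx' t ⟨ht.1.le, ht.2.le⟩
  have h4 := h1.unique (h2.congr_of_eventuallyEq h3)
  simp only [InnerProductSpace.toDual_apply_apply] at h4
  exact (inner_eq_one_iff_of_norm_eq_one (F.norm_eq _ hy) he).1 h4

/-- If the gradient is differentiable at `x` with derivative `A`, it is differentiable along the
whole line through `x`, with derivative `A (1 + s A)⁻¹` at distance `s`: the map `y ↦ y + s e y` is
inverted by `y ↦ y - s e y`. -/
theorem hasFDerivAt_add_smul [CompleteSpace E] (F : IsEikonalField v e x₀ r) {x : E} {s : ℝ}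
    {A : E →L[ℝ] E} (hx : x ∈ ball x₀ (r / 8)) (hs : |s| < r / 8) (hA : HasFDerivAt e A x)
    (hsA : ‖s • A‖ < 1) :
    HasFDerivAt e (A * Ring.inverse (1 + s • A)) (x + s • e x) := by
  have hr : 0 < r := by linarith [abs_nonneg s]
  have hx2 : x ∈ ball x₀ (r / 2) := ball_subset_ball (by linarith) hx
  have hx1 : x ∈ ball x₀ r := ball_subset_ball (by linarith) hx
  have hy : x + s • e x ∈ ball x₀ (r / 4) :=
    add_smul_mem_ball hx (F.norm_eq x hx1) (by linarith)
  have hU : IsUnit (1 + s • A) := by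
    have := isUnit_one_sub_of_norm_lt_one (x := -(s • A)) (by rwa [norm_neg])
    rwa [sub_neg_eq_add] at this
  have hey : e (x + s • e x) = e x := F.apply_add_smul hx2 (by linarith)
  have hback : x + s • e x - s • e (x + s • e x) = x := by rw [hey]; abel
  have hback' : ∀ᶠ y in 𝓝 (x + s • e x), e (y - s • e y) = e y := by
    filter_upwards [isOpen_ball.mem_nhds hy] with y hy
    have := F.apply_add_smul (s := -s) (ball_subset_ball (by linarith) hy)
      (by rw [abs_neg]; linarith)
    simpa [sub_eq_add_neg] using this
  have hcont : ContinuousAt e (x + s • e x) :=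
    (F.lipschitzOnWith hr).continuousOn.continuousAt (isOpen_ball.mem_nhds hy)
  set g : E → E := fun y => y - s • e y with hg
  have hgy : g (x + s • e x) = x := hback
  let f' : E ≃L[ℝ] E := ContinuousLinearEquiv.unitsEquiv ℝ E hU.unit
  have hf' : (f' : E →L[ℝ] E) = 1 + s • A := by
    ext w
    simp [f', ContinuousLinearEquiv.unitsEquiv_apply]
  have hsymm : (f'.symm : E →L[ℝ] E) = Ring.inverse (1 + s • A) := by
    have : Ring.inverse (1 + s • A) = ((hU.unit⁻¹ : (E →L[ℝ] E)ˣ) : E →L[ℝ] E) := by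
      rw [← Ring.inverse_unit, hU.unit_spec]
    rw [this]
    rfl
  have hinv : HasFDerivAt g (f'.symm : E →L[ℝ] E) (x + s • e x) := by
    refine HasFDerivAt.of_local_left_inverse (f := fun z => z + s • e z)
      (continuousAt_id.sub (hcont.const_smul s)) ?_ ?_
    · rw [hgy, hf']
      exact (hasFDerivAt_id x).add (hA.const_smul s)
    · filter_upwards [hback'] with y hy
      simp only [hg, hy]
      abel
  have hcomp := HasFDerivAt.comp (x + s • e x) (g := e) (f := g) (by rw [hgy]; exact hA) hinv
  rw [hsymm] at hcomp
  exact hcomp.congr_of_eventuallyEq (hback'.mono fun y hy => hy.symm)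

end IsEikonalField

end Field

/-! ### The divergence of the gradient field -/

section MeanCurvature

variable {E : Type*} [NormedAddCommGroup E] [InnerProductSpace ℝ E] [FiniteDimensional ℝ E]
variable {G h k : ℝ → ℝ} {v : E → ℝ} {e : E → E} {x₀ : E} {r : ℝ}

theorem IsNormalizedSolution.mem_ball_level (S : IsNormalizedSolution G h k v x₀ (12 * r))
    (hr : 0 < r) {ρ : ℝ} (hρ : ρ ≤ 4 * r) {x : E} (hx : x ∈ ball x₀ ρ) :
    v x ∈ ball (v x₀) ρ := by
  have hx4 : x ∈ ball x₀ (4 * r) := ball_subset_ball hρ hx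
  have hx₀4 : x₀ ∈ ball x₀ (4 * r) := mem_ball_self (by linarith)
  have h1 := S.sub_le_norm hr hx4 hx₀4
  have h2 := S.sub_le_norm hr hx₀4 hx4
  rw [norm_sub_rev] at h1
  rw [mem_ball, dist_eq_norm] at hx
  rw [mem_ball, Real.dist_eq, abs_lt]
  constructor <;> linarith

theorem IsNormalizedSolution.exists_isEikonalField
    (S : IsNormalizedSolution G h k v x₀ (12 * r)) (hr : 0 < r) :
    ∃ e : E → E, IsEikonalField v e x₀ r := by
  classical
  have := fun (x : E) (hx : x ∈ ball x₀ r) => S.exists_gradient hr hx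
  choose! e he using this
  exact ⟨e, fun x hx => (he x hx).1, fun x hx => (he x hx).2.1,
    fun x hx z hz => (he x hx).2.2 z (ball_subset_ball (by linarith) hz)⟩

theorem IsEikonalField.hasUpperJetAt (F : IsEikonalField v e x₀ r) {x : E} {A : E →L[ℝ] E}
    (hx : x ∈ ball x₀ r) (hA : HasFDerivAt e A x) :
    HasUpperJetAt v (e x) A x ∧ HasUpperJetAt (fun z => -v z) (-e x) (-A) x := by
  have h := isLittleO_sub_quadPoly (v := v) (e := e) (A := A) (x := x)
    (by filter_upwards [isOpen_ball.mem_nhds hx] with z hz using F.hasGradientAt hz) hA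
  refine ⟨⟨v, h, Eventually.of_forall fun _ => le_rfl⟩,
    ⟨fun z => -v z, h.neg_left.congr_left fun z => ?_, Eventually.of_forall fun _ => le_rfl⟩⟩
  simp only [quadPoly, inner_neg_left, neg_apply]
  ring

/-- Formally, `k (v x) ≤ Δ (Γ ∘ v) = Γ' Δ v + Γ'' |∇ v| ^ 2`, with `Δ v` the trace of `A`, for `Γ`
touching `G` from above. -/
theorem IsNormalizedSolution.le_of_touching_above {R : ℝ} (S : IsNormalizedSolution G h k v x₀ R)
    (F : IsEikonalField v e x₀ r) {x : E} {A : E →L[ℝ] E} (hxR : x ∈ ball x₀ R)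
    (hx : x ∈ ball x₀ r) (hA : HasFDerivAt e A x) {Γ : ℝ → ℝ} {b : ℝ}
    (hΓ : (fun t => Γ t - (G (v x) + h (v x) * (t - v x) + b / 2 * (t - v x) ^ 2)) =o[𝓝 (v x)]
      fun t => (t - v x) ^ 2)
    (hle : ∀ᶠ t in 𝓝 (v x), G t ≤ Γ t) : k (v x) ≤ h (v x) * opTrace A + b := by
  have := S.upperJet x hxR _ _
    ((F.hasUpperJetAt hx hA).1.comp_monotone S.strictMono.monotone hΓ hle)
  rw [opTrace_add, opTrace_smul, opTrace_smul, opTrace_toSpanSingleton, F.norm_eq x hx] at this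
  linarith

/-- The counterpart of `IsNormalizedSolution.le_of_touching_above` for `Γ` touching `G` from below. -/
theorem IsNormalizedSolution.le_of_touching_below {R : ℝ} (S : IsNormalizedSolution G h k v x₀ R)
    (F : IsEikonalField v e x₀ r) {x : E} {A : E →L[ℝ] E} (hxR : x ∈ ball x₀ R)
    (hx : x ∈ ball x₀ r) (hA : HasFDerivAt e A x) {Γ : ℝ → ℝ} {b : ℝ}
    (hΓ : (fun t => Γ t - (G (v x) + h (v x) * (t - v x) + b / 2 * (t - v x) ^ 2)) =o[𝓝 (v x)]
      fun t => (t - v x) ^ 2)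
    (hle : ∀ᶠ t in 𝓝 (v x), Γ t ≤ G t) : h (v x) * opTrace A + b ≤ k (v x) := by
  have := S.lowerJet x hxR _ _
    ((F.hasUpperJetAt hx hA).2.neg_comp_monotone S.strictMono.monotone hΓ hle)
  rw [opTrace_neg, opTrace_add, opTrace_smul, opTrace_smul, opTrace_toSpanSingleton,
    F.norm_eq x hx] at this
  linarith

theorem hasDerivAt_integral {f : ℝ → ℝ} (hf : Continuous f) (a t : ℝ) :
    HasDerivAt (fun t => ∫ s in a..t, f s) (f t) t :=
  intervalIntegral.integral_hasDerivAt_right (hf.intervalIntegrable _ _)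
    hf.aestronglyMeasurable.stronglyMeasurableAtFilter hf.continuousAt

/-- On the line through a point where the gradient field is differentiable, the trace `H` of its
derivative is a continuous function of the level. Viscosity comparison in one variable then
upgrades the second order equation to `h' = k - h H`; in particular `G` is of class `C²`. -/
theorem IsNormalizedSolution.exists_hasDerivAt_of_hasFDerivAt
    (S : IsNormalizedSolution G h k v x₀ (12 * r))
    (hr : 0 < r) (F : IsEikonalField v e x₀ r) {x : E} {A : E →L[ℝ] E} (hx : x ∈ ball x₀ (r / 8))
    (hA : HasFDerivAt e A x) :
    ∃ H : ℝ → ℝ, Continuous H ∧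
      ∀ σ ∈ Ioo (v x - r / 16) (v x + r / 16), HasDerivAt h (k σ - h σ * H σ) σ := by
  have hx4 : x ∈ ball x₀ (r / 4) := ball_subset_ball (by linarith) hx
  have hx1 : x ∈ ball x₀ r := ball_subset_ball (by linarith) hx
  have hnA : ‖A‖ ≤ 3 / r := by
    have := hA.le_of_lipschitzOn (isOpen_ball.mem_nhds hx4) (F.lipschitzOnWith hr)
    rwa [Real.coe_toNNReal _ (by positivity)] at this
  have hsA : ∀ s : ℝ, |s| < r / 8 → ‖s • A‖ < 1 := by
    intro s hs
    rw [norm_smul, Real.norm_eq_abs]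
    calc |s| * ‖A‖ ≤ r / 8 * (3 / r) := by gcongr
      _ = 3 / 8 := by field_simp
      _ < 1 := by norm_num
  -- the trace of the derivative of `e` at the point of level `σ` on the line through `x`
  set H₀ : ℝ → ℝ := fun σ => opTrace (A * Ring.inverse (1 + (σ - v x) • A)) with hH₀
  set α := v x - r / 16 with hα
  set β := v x + r / 16 with hβ
  have hαβ : α ≤ β := by linarith
  have habs : ∀ σ ∈ Icc α β, |σ - v x| < r / 8 := fun σ hσ =>
    abs_lt.2 ⟨by linarith [hσ.1], by linarith [hσ.2]⟩
  have hH₀c : ContinuousOn H₀ (Icc α β) := by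
    intro σ hσ
    refine ContinuousAt.continuousWithinAt ?_
    have hU : IsUnit (1 + (σ - v x) • A) := by
      have := isUnit_one_sub_of_norm_lt_one (x := -((σ - v x) • A))
        (by rw [norm_neg]; exact hsA _ (habs σ hσ))
      rwa [sub_neg_eq_add] at this
    have h1 : ContinuousAt Ring.inverse (1 + (σ - v x) • A) := by
      have := NormedRing.inverse_continuousAt hU.unit
      rwa [hU.unit_spec] at this
    have h2 : ContinuousAt (fun σ : ℝ => 1 + (σ - v x) • A) σ := by fun_prop
    have h3 : ContinuousAt (fun σ : ℝ => Ring.inverse (1 + (σ - v x) • A)) σ :=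
      ContinuousAt.comp (f := fun σ : ℝ => 1 + (σ - v x) • A) h1 h2
    exact continuous_opTrace.continuousAt.comp (continuousAt_const.mul h3)
  set H : ℝ → ℝ := IccExtend hαβ ((Icc α β).domRestrict H₀) with hH
  have hHc : Continuous H := hH₀c.domRestrict.Icc_extend'
  have hHeq : ∀ σ ∈ Icc α β, H σ = H₀ σ := fun σ hσ => by
    rw [hH, IccExtend_of_mem hαβ _ hσ, domRestrict_apply]
  -- the point of the line at level `σ`
  have hpt : ∀ σ ∈ Ioo α β, ∃ y ∈ ball x₀ r, v y = σ ∧ ∃ B, HasFDerivAt e B y ∧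
      opTrace B = H σ := by
    intro σ hσ
    have hσ' := Ioo_subset_Icc_self hσ
    have hs := habs σ hσ'
    refine ⟨x + (σ - v x) • e x, add_smul_mem_ball hx (F.norm_eq x hx1) (by linarith), ?_, _,
      F.hasFDerivAt_add_smul hx hs hA (hsA _ hs), (hHeq σ hσ').symm⟩
    rw [F.line x hx1 _ ⟨by linarith [(abs_lt.1 hs).1], by linarith [(abs_lt.1 hs).2]⟩]
    ring
  set m : ℝ → ℝ := fun σ => k σ - h σ * H σ with hm
  have hmc : Continuous m := S.continuous_k.sub (S.continuous_h.mul hHc)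
  set M₁ : ℝ → ℝ := fun t => ∫ s in v x..t, m s with hM₁
  have hM₁d : ∀ t, HasDerivAt M₁ (m t) t := fun t => hasDerivAt_integral hmc _ t
  have hsub : ball x₀ r ⊆ ball x₀ (12 * r) := ball_subset_ball (by linarith)
  have hanti := antitoneOn_sub_primitive (α := α) (β := β) S.hasDerivAt hM₁d (by
    intro σ hσ b Γ hΓ hle
    obtain ⟨y, hy, hvy, B, hB, hBH⟩ := hpt σ hσ
    have := S.le_of_touching_below F (hsub hy) hy hB (Γ := Γ) (b := b)
      (by rw [hvy]; exact hΓ) (by rw [hvy]; exact hle)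
    rw [hvy, hBH] at this
    simp only [hm]
    linarith)
  have hanti' := antitoneOn_sub_primitive (G := fun t => -G t) (h := fun t => -h t)
    (m := fun t => -m t) (M₁ := fun t => -M₁ t) (α := α) (β := β) (fun t => (S.hasDerivAt t).neg)
    (fun t => (hM₁d t).neg) (by
    intro σ hσ b Γ hΓ hle
    obtain ⟨y, hy, hvy, B, hB, hBH⟩ := hpt σ hσ
    have := S.le_of_touching_above F (hsub hy) hy hB (Γ := fun t => -Γ t) (b := -b)
      (by
        rw [hvy]
        refine hΓ.neg_left.congr_left fun t => ?_
        ring)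
      (by
        rw [hvy]
        filter_upwards [hle] with t ht
        linarith)
    rw [hvy, hBH] at this
    simp only [hm]
    linarith)
  refine ⟨H, hHc, fun σ hσ => ?_⟩
  have hconst : ∀ t ∈ Ioo α β, h t = M₁ t + (h σ - M₁ σ) := by
    intro t ht
    rcases le_total t σ with hle | hle
    · have h1 := hanti ht hσ hle
      have h2 := hanti' ht hσ hle
      simp only at h1 h2
      linarith
    · have h1 := hanti hσ ht hle
      have h2 := hanti' hσ ht hle
      simp only at h1 h2
      linarith
  exact ((hM₁d σ).add_const _).congr_of_eventuallyEq
    (by filter_upwards [Ioo_mem_nhds hσ.1 hσ.2] with t ht using hconst t ht)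

/-- The divergence of the gradient field is a function of the level, wherever the gradient field is
differentiable: as `G` is twice differentiable at the level, it is its own comparison function
from above and from below, and the second order equation holds with equality. -/
theorem IsNormalizedSolution.opTrace_eq {R : ℝ} (S : IsNormalizedSolution G h k v x₀ R)
    (F : IsEikonalField v e x₀ r) {x : E} {A : E →L[ℝ] E} (hxR : x ∈ ball x₀ R)
    (hx : x ∈ ball x₀ r) (hA : HasFDerivAt e A x) {η : ℝ}
    (hh : HasDerivAt h (k (v x) - h (v x) * η) (v x)) : opTrace A = η := by
  have htaylor := isLittleO_sub_quadPoly (v := G) (e := h) (x := v x)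
    (Eventually.of_forall fun t => (S.hasDerivAt t).hasGradientAt') hh.hasFDerivAt
  have hΓ : (fun t => G t - (G (v x) + h (v x) * (t - v x) +
      (k (v x) - h (v x) * η) / 2 * (t - v x) ^ 2)) =o[𝓝 (v x)] fun t => (t - v x) ^ 2 := by
    refine (htaylor.congr_left fun t => ?_).congr_right fun t => ?_
    · simp only [quadPoly]
      simp
      ring
    · simp
  have h1 := S.le_of_touching_above F hxR hx hA hΓ (Eventually.of_forall fun _ => le_rfl)
  have h2 := S.le_of_touching_below F hxR hx hA hΓ (Eventually.of_forall fun _ => le_rfl)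
  have h3 : h (v x) * (opTrace A - η) = 0 := by linarith
  have := (mul_eq_zero.1 h3).resolve_left (S.h_pos _).ne'
  linarith

variable [MeasurableSpace E] [BorelSpace E]

/-- Rademacher's theorem for the gradient field. -/
theorem IsEikonalField.ae_differentiableAt (F : IsEikonalField v e x₀ r) (hr : 0 < r) :
    ∀ᵐ x, x ∈ ball x₀ (r / 4) → DifferentiableAt ℝ e x := by
  filter_upwards [(F.lipschitzOnWith hr).ae_differentiableWithinAt_of_mem
    (μ := MeasureTheory.volume)] with x hx hxb
  exact (hx hxb).differentiableAt (isOpen_ball.mem_nhds hxb)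

/-- Near the centre, `h' = k - h H` for a continuous function `H` of the level, and `H (v x)` is the
trace of the derivative of the gradient field at `x` wherever this derivative exists. -/
theorem IsNormalizedSolution.exists_hasDerivAt (S : IsNormalizedSolution G h k v x₀ (12 * r))
    (hr : 0 < r) (F : IsEikonalField v e x₀ r) :
    ∃ H : ℝ → ℝ, Continuous H ∧
      (∀ σ ∈ ball (v x₀) (r / 32), HasDerivAt h (k σ - h σ * H σ) σ) ∧
      ∀ x ∈ ball x₀ (r / 32), ∀ A, HasFDerivAt e A x → opTrace A = H (v x) := by
  have hdense := MeasureTheory.Measure.dense_of_ae (F.ae_differentiableAt hr)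
  obtain ⟨x₁, hx₁, hd⟩ := hdense.exists_mem_open isOpen_ball
    (nonempty_ball.2 (show 0 < r / 32 by positivity) : (ball x₀ (r / 32)).Nonempty)
  have hdiff := hx₁ (ball_subset_ball (by linarith) hd)
  obtain ⟨H, hHc, hH⟩ := S.exists_hasDerivAt_of_hasFDerivAt hr F
    (ball_subset_ball (by linarith) hd) hdiff.hasFDerivAt
  have hlevel : ∀ σ ∈ ball (v x₀) (r / 32), HasDerivAt h (k σ - h σ * H σ) σ := by
    intro σ hσ
    have h1 := S.mem_ball_level hr (by linarith) hd
    rw [mem_ball, Real.dist_eq, abs_lt] at h1 hσ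
    exact hH _ ⟨by linarith, by linarith⟩
  exact ⟨H, hHc, hlevel, fun x hx A hA => S.opTrace_eq F (ball_subset_ball (by linarith) hx)
    (ball_subset_ball (by linarith) hx) hA (hlevel _ (S.mem_ball_level hr (by linarith) hx))⟩

end MeanCurvature

/-! ### Weyl's lemma for functions with a Lipschitz gradient -/

section Weyl

open MeasureTheory
open scoped NNReal ContDiff

variable {E : Type*} [NormedAddCommGroup E] [InnerProductSpace ℝ E] [FiniteDimensional ℝ E]
  [MeasurableSpace E] [BorelSpace E]

/-- A radial bump function `η` together with a compactly supported potential `Ψ` whose gradient is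
`-η y • y`. -/
theorem exists_radial_bump {ρ : ℝ} (hρ : 0 < ρ) :
    ∃ η Ψ : E → ℝ, ContDiff ℝ ∞ η ∧ HasCompactSupport η ∧ (∀ y, ρ < ‖y‖ → η y = 0) ∧
      (∀ y, η (-y) = η y) ∧ 0 < ∫ y, η y ∧ ContDiff ℝ 1 Ψ ∧ HasCompactSupport Ψ ∧
      (∀ y, ρ < ‖y‖ → Ψ y = 0) ∧ ∀ y, HasGradientAt Ψ (-(η y) • y) y := by
  -- `η y = χ (‖y‖ ^ 2)` and `Ψ y = θ (‖y‖ ^ 2)` with `2 θ' = -χ`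
  let χ : ContDiffBump (0 : ℝ) :=
    ⟨ρ ^ 2 / 2, ρ ^ 2, by positivity, by nlinarith [pow_pos hρ 2]⟩
  have hχ0 : ∀ s, ρ ^ 2 ≤ s → χ s = 0 := fun s hs => by
    refine χ.zero_of_le_dist ?_
    rw [Real.dist_eq, sub_zero]
    exact hs.trans (le_abs_self s)
  set θ : ℝ → ℝ := fun s => ∫ t in (ρ ^ 2)..s, -(χ t / 2) with hθ
  have hχc : Continuous fun t => -(χ t / 2) := (χ.continuous.div_const 2).neg
  have hθd : ∀ s, HasDerivAt θ (-(χ s / 2)) s := fun s => hasDerivAt_integral hχc _ s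
  have hθ0 : ∀ s, ρ ^ 2 ≤ s → θ s = 0 := by
    intro s hs
    refine intervalIntegral.integral_zero_ae (Eventually.of_forall fun t ht => ?_)
    rw [uIoc_of_le hs] at ht
    simp [hχ0 t ht.1.le]
  have hθC : ContDiff ℝ 1 θ := by
    rw [contDiff_one_iff_deriv]
    refine ⟨fun s => (hθd s).differentiableAt, ?_⟩
    have : deriv θ = fun t => -(χ t / 2) := funext fun s => (hθd s).deriv
    rwa [this]
  have hout : ∀ y : E, ρ < ‖y‖ → ρ ^ 2 ≤ ‖y‖ ^ 2 := fun y hy => by gcongr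
  have hηC : ContDiff ℝ ∞ fun y : E => χ (‖y‖ ^ 2) := χ.contDiff.comp (contDiff_norm_sq ℝ)
  have hηs : HasCompactSupport fun y : E => χ (‖y‖ ^ 2) := by
    refine HasCompactSupport.intro (isCompact_closedBall (0 : E) ρ) fun y hy => ?_
    exact hχ0 _ (hout y (by simpa using hy))
  refine ⟨fun y => χ (‖y‖ ^ 2), fun y => θ (‖y‖ ^ 2), hηC, hηs, fun y hy => hχ0 _ (hout y hy),
    fun y => by simp, ?_, hθC.comp (contDiff_norm_sq ℝ), ?_, fun y hy => hθ0 _ (hout y hy), ?_⟩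
  · refine hηC.continuous.integral_pos_of_hasCompactSupport_nonneg_nonzero hηs
      (fun y => χ.nonneg) (x := 0) ?_
    have : χ 0 = 1 := χ.one_of_mem_closedBall (mem_closedBall_self χ.rIn_pos.le)
    simp [this]
  · refine HasCompactSupport.intro (isCompact_closedBall (0 : E) ρ) fun y hy => ?_
    exact hθ0 _ (hout y (by simpa using hy))
  · intro y
    rw [hasGradientAt_iff_hasFDerivAt]
    refine ((hθd (‖y‖ ^ 2)).comp_hasFDerivAt y
      (hasStrictFDerivAt_norm_sq y).hasFDerivAt).congr_fderiv ?_
    ext z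
    simp
    ring

/-- Integration by parts for a Lipschitz vector field against a compactly supported potential. -/
theorem integral_inner_gradient_eq {Y : E → E} {K : ℝ≥0} (hY : LipschitzWith K Y) {Ψ : E → ℝ}
    {g : E → E} (hΨ : ContDiff ℝ 1 Ψ) (hΨs : HasCompactSupport Ψ)
    (hg : ∀ y, HasGradientAt Ψ (g y) y) :
    ∫ y, ⟪Y y, g y⟫ = -∫ y, opTrace (fderiv ℝ Y y) * Ψ y := by
  set b := stdOrthonormalBasis ℝ E
  obtain ⟨D, hD⟩ := hΨ.lipschitzWith_of_hasCompactSupport hΨs (by simp)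
  have hYi : ∀ i, LipschitzWith (‖innerSL ℝ (b i)‖₊ * K) fun y => ⟪b i, Y y⟫ := fun i =>
    (innerSL ℝ (b i)).lipschitz.comp hY
  have hline : ∀ i y, lineDeriv ℝ Ψ y (-(b i)) = -⟪b i, g y⟫ := by
    intro i y
    have h1 := hasGradientAt_iff_hasFDerivAt.1 (hg y)
    rw [h1.differentiableAt.lineDeriv_eq_fderiv, h1.fderiv]
    simp [real_inner_comm]
  have hparts : ∀ i, ∫ y, lineDeriv ℝ (fun y => ⟪b i, Y y⟫) y (b i) * Ψ y =
      ∫ y, -(⟪b i, g y⟫ * ⟪b i, Y y⟫) := by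
    intro i
    rw [(hYi i).integral_lineDeriv_mul_eq hD hΨs (b i)]
    refine integral_congr_ae (Eventually.of_forall fun y => ?_)
    simp only [hline]
    ring
  have hint : ∀ i, Integrable fun y => lineDeriv ℝ (fun y => ⟪b i, Y y⟫) y (b i) * Ψ y := by
    intro i
    have := ((hYi i).locallyIntegrable_lineDeriv (μ := volume)
      (b i)).integrable_smul_left_of_hasCompactSupport hΨ.continuous hΨs
    refine this.congr (Eventually.of_forall fun y => ?_)
    simp [mul_comm]
  have hgc : Continuous g := by
    have h1 : g = fun y => (InnerProductSpace.toDual ℝ E).symm (fderiv ℝ Ψ y) := by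
      ext1 y
      rw [(hasGradientAt_iff_hasFDerivAt.1 (hg y)).fderiv, LinearIsometryEquiv.symm_apply_apply]
    rw [h1]
    exact (InnerProductSpace.toDual ℝ E).symm.continuous.comp (hΨ.continuous_fderiv (by simp))
  have hgs : HasCompactSupport g := by
    have h1 : g = (InnerProductSpace.toDual ℝ E).symm ∘ fderiv ℝ Ψ := by
      ext1 y
      simp only [Function.comp]
      rw [(hasGradientAt_iff_hasFDerivAt.1 (hg y)).fderiv, LinearIsometryEquiv.symm_apply_apply]
    rw [h1]
    exact (hΨs.fderiv ℝ).comp_left (map_zero _)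
  have hint2 : ∀ i, Integrable fun y => -(⟪b i, g y⟫ * ⟪b i, Y y⟫) := by
    intro i
    refine Continuous.integrable_of_hasCompactSupport ?_ ?_
    · have := hY.continuous
      fun_prop
    · refine HasCompactSupport.of_support_subset_isCompact hgs fun y hy => ?_
      by_contra hcon
      exact hy (by simp [image_eq_zero_of_notMem_tsupport hcon])
  have hsum1 : ∀ y, ⟪Y y, g y⟫ = -∑ i, -(⟪b i, g y⟫ * ⟪b i, Y y⟫) := by
    intro y
    rw [← b.sum_inner_mul_inner (Y y) (g y), Finset.sum_neg_distrib, neg_neg]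
    refine Finset.sum_congr rfl fun i _ => ?_
    rw [real_inner_comm (b i) (Y y)]
    ring
  have hsum2 : (fun y => opTrace (fderiv ℝ Y y) * Ψ y) =ᵐ[volume]
      fun y => ∑ i, lineDeriv ℝ (fun y => ⟪b i, Y y⟫) y (b i) * Ψ y := by
    filter_upwards [hY.ae_differentiableAt (μ := volume)] with y hy
    rw [← Finset.sum_mul, opTrace_eq_sum b]
    congr 1
    refine Finset.sum_congr rfl fun i _ => ?_
    have h1 : HasFDerivAt (fun y => ⟪b i, Y y⟫) ((innerSL ℝ (b i)).comp (fderiv ℝ Y y)) y :=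
      (innerSL ℝ (b i)).hasFDerivAt.comp y hy.hasFDerivAt
    rw [h1.differentiableAt.lineDeriv_eq_fderiv, h1.fderiv]
    simp
  rw [integral_congr_ae hsum2, integral_finsetSum _ fun i _ => hint i,
    Finset.sum_congr rfl fun i _ => hparts i, ← integral_finsetSum _ fun i _ => hint2 i,
    ← integral_neg]
  exact integral_congr_ae (Eventually.of_forall hsum1)

theorem ae_comp_add_smul {p : E → Prop} (hp : ∀ᵐ z, p z) (x : E) {t : ℝ} (ht : t ≠ 0) :
    ∀ᵐ y, p (x + t • y) := by
  rw [ae_iff] at hp ⊢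
  have h1 : {y | ¬p (x + t • y)} = (fun y => t • y) ⁻¹' ((fun z => x + z) ⁻¹' {z | ¬p z}) := rfl
  rw [h1, Measure.addHaar_preimage_smul volume ht, measure_preimage_add, hp, mul_zero]

/-- Weyl's lemma for functions with a Lipschitz gradient: if the gradient field is divergence free
almost everywhere, the function agrees with its means over small balls, weighted by a radial bump
function, and hence is smooth. The means do not depend on the radius, since their derivative with
respect to the radius is the integral of the gradient against the gradient of a radial
potential. -/
theorem contDiffAt_of_opTrace_eq_zero {w : E → ℝ} {X : E → E} {x₀ : E} {R : ℝ} {K : ℝ≥0}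
    (hR : 0 < R) (hw : ∀ x ∈ ball x₀ R, HasGradientAt w (X x) x)
    (hX : LipschitzOnWith K X (ball x₀ R))
    (hdiv : ∀ x ∈ ball x₀ R, ∀ A, HasFDerivAt X A x → opTrace A = 0) : ContDiffAt ℝ ∞ w x₀ := by
  have hx₀ : x₀ ∈ ball x₀ R := mem_ball_self hR
  have hwL : LipschitzOnWith (‖X x₀‖₊ + K * Real.toNNReal R) w (ball x₀ R) := by
    refine (convex_ball x₀ R).lipschitzOnWith_of_nnnorm_hasFDerivWithin_le
      (fun x hx => (hasGradientAt_iff_hasFDerivAt.1 (hw x hx)).hasFDerivWithinAt) fun x hx => ?_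
    rw [← NNReal.coe_le_coe]
    simp only [coe_nnnorm, NNReal.coe_add, NNReal.coe_mul, Real.coe_toNNReal _ hR.le,
      LinearIsometryEquiv.norm_map]
    have h1 := hX.norm_sub_le hx hx₀
    have h2 : ‖X x‖ ≤ ‖X x₀‖ + ‖X x - X x₀‖ := norm_le_insert' _ _
    have h3 : ‖x - x₀‖ ≤ R := by
      rw [← dist_eq_norm]; exact (mem_ball.1 hx).le
    have h4 : (K : ℝ) * ‖x - x₀‖ ≤ K * R := by gcongr
    linarith
  -- global Lipschitz extensions, so that all integrals make sense on the whole space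
  obtain ⟨w', hw', hww'⟩ := hwL.extend_finite_dimension
  obtain ⟨X', hX', hXX'⟩ := hX.extend_finite_dimension
  set Kw := lipschitzExtensionConstant ℝ * (‖X x₀‖₊ + K * Real.toNNReal R)
  set ρ := R / 4 with hρ
  have hρ0 : 0 < ρ := by positivity
  obtain ⟨η, Ψ, hηC, hηs, hη0, hηneg, hηpos, hΨC, hΨs, hΨ0, hΨg⟩ := exists_radial_bump (E := E) hρ0
  have hηc := hηC.continuous
  have hmem : ∀ x ∈ ball x₀ ρ, ∀ t : ℝ, |t| < 2 → ∀ y : E, ‖y‖ ≤ ρ → x + t • y ∈ ball x₀ R := by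
    intro x hx t ht y hy
    rw [mem_ball, dist_eq_norm] at hx ⊢
    have h1 : x + t • y - x₀ = (x - x₀) + t • y := by abel
    rw [h1]
    have h2 := norm_add_le (x - x₀) (t • y)
    rw [norm_smul, Real.norm_eq_abs] at h2
    nlinarith [norm_nonneg y, abs_nonneg t]
  -- the weighted mean over the ball of radius `t ρ` does not depend on `t ∈ [0, 1]`
  have hmean : ∀ x ∈ ball x₀ ρ, ∫ y, w' (x + y) * η y = w' x * ∫ y, η y := by
    intro x hx
    set I : ℝ → ℝ := fun t => ∫ y, w' (x + t • y) * η y with hI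
    have hder : ∀ t : ℝ, |t| < 2 → HasDerivAt I 0 t := by
      intro t ht
      have hzero : ∫ y, ⟪X' (x + t • y), y⟫ * η y = 0 := by
        have hYL : LipschitzWith (lipschitzExtensionConstant E * K * ‖t‖₊)
            fun y => X' (x + t • y) :=
          hX'.comp (LipschitzWith.of_dist_le_mul fun y z => by
            rw [dist_add_left, dist_smul₀, coe_nnnorm])
        have hparts := integral_inner_gradient_eq hYL hΨC hΨs hΨg
        have hrhs : ∫ y, opTrace (fderiv ℝ (fun y => X' (x + t • y)) y) * Ψ y = 0 := by
          rcases eq_or_ne t 0 with rfl | ht0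
          · simp [opTrace]
          · have hae := ae_comp_add_smul (hX'.ae_differentiableAt (μ := volume)) x ht0
            refine integral_eq_zero_of_ae ?_
            filter_upwards [hae] with y hy
            rcases lt_or_ge ρ ‖y‖ with hout | hin
            · simp [hΨ0 y hout]
            · have hz := hmem x hx t ht y hin
              have h1 : HasFDerivAt (fun y : E => x + t • y)
                  (t • ContinuousLinearMap.id ℝ E) y :=
                ((hasFDerivAt_id y).const_smul t).const_add x
              have h2 : HasFDerivAt (fun y => X' (x + t • y))
                ((fderiv ℝ X' (x + t • y)).comp (t • ContinuousLinearMap.id ℝ E)) y :=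
                HasFDerivAt.comp y hy.hasFDerivAt h1
              have h3 : HasFDerivAt X (fderiv ℝ X' (x + t • y)) (x + t • y) :=
                hy.hasFDerivAt.congr_of_eventuallyEq
                  (hXX'.eventuallyEq_of_mem (isOpen_ball.mem_nhds hz))
              have h4 : (fderiv ℝ X' (x + t • y)).comp (t • ContinuousLinearMap.id ℝ E) =
                  t • fderiv ℝ X' (x + t • y) := by
                ext z; simp
              rw [h2.fderiv, h4, opTrace_smul, hdiv _ hz _ h3]
              simp
        rw [hrhs, neg_zero] at hparts
        rw [← neg_eq_zero, ← integral_neg, ← hparts]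
        refine integral_congr_ae (Eventually.of_forall fun y => ?_)
        simp only [real_inner_smul_right]
        ring
      rw [← hzero]
      refine (hasDerivAt_integral_of_dominated_loc_of_lip (μ := volume) (s := univ)
        (bound := fun y => Kw * ‖y‖ * ‖η y‖) univ_mem ?_ ?_ ?_ ?_ ?_ ?_).2
      · refine Eventually.of_forall fun t => Continuous.aestronglyMeasurable ?_
        have := hw'.continuous
        fun_prop
      · refine Continuous.integrable_of_hasCompactSupport ?_ hηs.mul_left
        have := hw'.continuous
        fun_prop
      · refine Continuous.aestronglyMeasurable ?_
        have := hX'.continuous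
        fun_prop
      · refine Eventually.of_forall fun y => (LipschitzOnWith.of_dist_le_mul fun s _ s' _ => ?_)
        rw [Real.coe_nnabs, abs_of_nonneg (by positivity), Real.dist_eq, ← sub_mul, abs_mul,
          ← Real.norm_eq_abs (η y)]
        have h1 := hw'.dist_le_mul (x + s • y) (x + s' • y)
        rw [Real.dist_eq, dist_add_left, dist_eq_norm, ← sub_smul, norm_smul,
          ← dist_eq_norm] at h1
        calc |w' (x + s • y) - w' (x + s' • y)| * ‖η y‖
            ≤ (Kw * (dist s s' * ‖y‖)) * ‖η y‖ := by gcongr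
          _ = _ := by ring
      · refine Continuous.integrable_of_hasCompactSupport (by fun_prop) ?_
        exact hηs.norm.mul_left
      · refine Eventually.of_forall fun y => ?_
        rcases lt_or_ge ρ ‖y‖ with hout | hin
        · simp only [hη0 y hout, mul_zero]
          exact hasDerivAt_const _ _
        · have hz := hmem x hx t ht y hin
          have h1 : HasDerivAt (fun t : ℝ => x + t • y) y t := by
            simpa using ((hasDerivAt_id t).smul_const y).const_add x
          have h2 : HasFDerivAt w' (InnerProductSpace.toDual ℝ E (X (x + t • y))) (x + t • y) :=
            (hasGradientAt_iff_hasFDerivAt.1 (hw _ hz)).congr_of_eventuallyEq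
              ((hww'.eventuallyEq_of_mem (isOpen_ball.mem_nhds hz)).symm)
          have h3 := (h2.comp_hasDerivAt t h1).mul_const (η y)
          rw [← hXX' hz]
          simpa using h3
    have hconst := constant_of_has_deriv_right_zero (f := I) (a := 0) (b := 1)
      (fun t ht => (hder t
        (by rw [abs_of_nonneg ht.1]; linarith [ht.2])).continuousAt.continuousWithinAt)
      (fun t ht => (hder t (by rw [abs_of_nonneg ht.1]; linarith [ht.2])).hasDerivWithinAt)
      1 (right_mem_Icc.2 zero_le_one)
    simp only [hI, one_smul, zero_smul, add_zero] at hconst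
    rw [hconst, integral_const_mul]
  have hsmooth : ContDiff ℝ ∞ fun x => ∫ y, w' (x + y) * η y := by
    have h1 := hηs.contDiff_convolution_left (ContinuousLinearMap.mul ℝ ℝ) (μ := volume)
      (n := ⊤) hηC hw'.continuous.locallyIntegrable
    have h2 : (fun x => ∫ y, w' (x + y) * η y) =
        convolution η w' (ContinuousLinearMap.mul ℝ ℝ) volume := by
      ext x
      rw [convolution_def, ← integral_neg_eq_self]
      refine integral_congr_ae (Eventually.of_forall fun y => ?_)
      simp [hηneg, mul_comm, sub_eq_add_neg]
    rw [h2]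
    exact h1
  have heq : w =ᶠ[𝓝 x₀] fun x => (∫ y, w' (x + y) * η y) / ∫ y, η y := by
    filter_upwards [ball_mem_nhds x₀ hρ0] with x hx
    rw [hmean x hx, mul_div_cancel_right₀ _ hηpos.ne']
    exact hww' (ball_subset_ball (by linarith) hx)
  exact (hsmooth.contDiffAt.div_const _).congr_of_eventuallyEq heq

end Weyl

/-! ### Regularity of normalized solutions -/

section Regularity

open scoped ContDiff NNReal

variable {E : Type*} [NormedAddCommGroup E] [InnerProductSpace ℝ E]
variable {G h k : ℝ → ℝ} {v : E → ℝ} {e : E → E} {x₀ : E} {r : ℝ}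

theorem lipschitzOnWith_smul_unit {q q' : ℝ → ℝ} (hq : ∀ t, HasDerivAt q (q' t) t)
    (hq' : Continuous q') {B : Set E} {a b : ℝ} (hvB : ∀ x ∈ B, v x ∈ Icc a b)
    (hvL : ∀ x ∈ B, ∀ y ∈ B, |v x - v y| ≤ ‖x - y‖) (he : ∀ x ∈ B, ‖e x‖ = 1) {K : ℝ≥0}
    (heL : LipschitzOnWith K e B) : ∃ K', LipschitzOnWith K' (fun x => q (v x) • e x) B := by
  have hqc : Continuous q := continuous_iff_continuousAt.2 fun t => (hq t).continuousAt
  obtain ⟨M, hM⟩ := isCompact_Icc.exists_bound_of_continuousOn (s := Icc a b) hqc.continuousOn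
  obtain ⟨N, hN⟩ := isCompact_Icc.exists_bound_of_continuousOn (s := Icc a b) hq'.continuousOn
  refine ⟨Real.toNNReal (M * K + N), LipschitzOnWith.of_dist_le_mul fun x hx y hy => ?_⟩
  have hM0 : 0 ≤ M := (norm_nonneg _).trans (hM _ (hvB x hx))
  have hN0 : 0 ≤ N := (norm_nonneg _).trans (hN _ (hvB x hx))
  rw [Real.coe_toNNReal _ (by positivity), dist_eq_norm, dist_eq_norm]
  have h1 : ‖q (v x) - q (v y)‖ ≤ N * ‖x - y‖ := by
    refine ((convex_Icc a b).norm_image_sub_le_of_norm_hasDerivWithin_le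
      (fun t _ => (hq t).hasDerivWithinAt) hN (hvB y hy) (hvB x hx)).trans ?_
    rw [Real.norm_eq_abs]
    gcongr
    exact hvL x hx y hy
  have h2 := heL.norm_sub_le hx hy
  have h3 : q (v x) • e x - q (v y) • e y =
      q (v x) • (e x - e y) + (q (v x) - q (v y)) • e y := by module
  rw [h3]
  calc _ ≤ ‖q (v x)‖ * ‖e x - e y‖ + ‖q (v x) - q (v y)‖ * ‖e y‖ := by
        rw [← norm_smul, ← norm_smul]; exact norm_add_le _ _
    _ ≤ M * (K * ‖x - y‖) + (N * ‖x - y‖) * 1 := by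
        rw [he y hy]
        gcongr
        exact hM _ (hvB x hx)
    _ = _ := by ring

variable [FiniteDimensional ℝ E] [MeasurableSpace E] [BorelSpace E]

/-- Regularity in the normalized situation. With `q' = -q H`, the function `w = P ∘ v`, where
`P' = q`, has a divergence free gradient, so it is smooth by Weyl's lemma; the gradient of `G ∘ v` is
a continuously differentiable multiple of the gradient of `w`. -/
theorem IsNormalizedSolution.contDiffAt (S : IsNormalizedSolution G h k v x₀ (12 * r))
    (hr : 0 < r) : ContDiffAt ℝ 2 (fun z => G (v z)) x₀ ∧
      ‖gradient (fun z => G (v z)) x₀‖ = h (v x₀) := by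
  obtain ⟨e, F⟩ := S.exists_isEikonalField hr
  obtain ⟨H, hHc, hh, htr⟩ := S.exists_hasDerivAt hr F
  set q : ℝ → ℝ := fun t => Real.exp (-∫ s in v x₀..t, H s) with hq
  have hq0 : ∀ t, 0 < q t := fun t => Real.exp_pos _
  have hqd : ∀ t, HasDerivAt q (-(q t * H t)) t := fun t => by
    have := (hasDerivAt_integral hHc (v x₀) t).neg.exp
    refine this.congr_deriv ?_
    simp [hq]
  have hqc : Continuous q := continuous_iff_continuousAt.2 fun t => (hqd t).continuousAt
  set P : ℝ → ℝ := fun t => ∫ s in v x₀..t, q s with hP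
  have hPd : ∀ t, HasDerivAt P (q t) t := fun t => hasDerivAt_integral hqc _ t
  set ρ := r / 32 with hρ
  have hρ0 : 0 < ρ := by positivity
  have hx₀ : x₀ ∈ ball x₀ ρ := mem_ball_self hρ0
  have hsub1 : ball x₀ ρ ⊆ ball x₀ r := ball_subset_ball (by linarith)
  have hsub4 : ball x₀ ρ ⊆ ball x₀ (4 * r) := ball_subset_ball (by linarith)
  have heL := (F.lipschitzOnWith hr).mono (ball_subset_ball (by linarith) : ball x₀ ρ ⊆ _)
  have hv : ∀ x ∈ ball x₀ ρ, HasFDerivAt v (InnerProductSpace.toDual ℝ E (e x)) x := fun x hx =>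
    hasGradientAt_iff_hasFDerivAt.1 (F.hasGradientAt (hsub1 hx))
  have hlev : ∀ x ∈ ball x₀ ρ, v x ∈ ball (v x₀) ρ := fun x hx =>
    S.mem_ball_level hr (by linarith) hx
  obtain ⟨K, hK⟩ := lipschitzOnWith_smul_unit (v := v) (e := e) (B := ball x₀ ρ) (a := v x₀ - ρ)
    (b := v x₀ + ρ) hqd (hqc.mul hHc).neg (fun x hx => by
      rw [← Real.closedBall_eq_Icc]
      exact ball_subset_closedBall (hlev x hx)) (fun x hx y hy => by
      have h1 := S.sub_le_norm hr (hsub4 hx) (hsub4 hy)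
      have h2 := S.sub_le_norm hr (hsub4 hy) (hsub4 hx)
      rw [norm_sub_rev] at h1
      exact abs_le.2 ⟨by linarith, by linarith⟩) (fun x hx => F.norm_eq x (hsub1 hx)) heL
  have hwd : ∀ x ∈ ball x₀ ρ, HasFDerivAt (fun z => P (v z))
      (q (v x) • InnerProductSpace.toDual ℝ E (e x)) x := fun x hx =>
    (hPd (v x)).comp_hasFDerivAt x (hv x hx)
  have hw : ContDiffAt ℝ ∞ (fun z => P (v z)) x₀ := by
    refine contDiffAt_of_opTrace_eq_zero hρ0 (X := fun x => q (v x) • e x) (fun x hx => ?_) hK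
      fun x hx B hB => ?_
    · rw [hasGradientAt_iff_hasFDerivAt]
      refine (hwd x hx).congr_fderiv ?_
      simp
    · have hqv : HasFDerivAt (fun z => q (v z))
          ((-(q (v x) * H (v x))) • InnerProductSpace.toDual ℝ E (e x)) x :=
        (hqd (v x)).comp_hasFDerivAt x (hv x hx)
      -- the factor `q ∘ v` can be divided out, so `e` is differentiable where `q (v) • e` is
      have hed : DifferentiableAt ℝ e x := by
        have h1 := (hqv.differentiableAt.inv (hq0 _).ne').smul hB.differentiableAt
        refine h1.congr_of_eventuallyEq (Eventually.of_forall fun z => ?_)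
        exact (inv_smul_smul₀ (hq0 _).ne' _).symm
      have h2 := hB.unique (hqv.smul hed.hasFDerivAt)
      have h3 : ((-(q (v x) * H (v x))) • InnerProductSpace.toDual ℝ E (e x)).smulRight (e x) =
          (-(q (v x) * H (v x))) • (innerSL ℝ (e x)).smulRight (e x) := by
        ext z
        simp [mul_smul]
      rw [h2, h3, opTrace_add, opTrace_smul, opTrace_smul, opTrace_toSpanSingleton,
        F.norm_eq x (hsub1 hx), htr x hx _ hed.hasFDerivAt]
      ring
  have hud : ∀ x ∈ ball x₀ ρ, HasFDerivAt (fun z => G (v z))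
      (h (v x) • InnerProductSpace.toDual ℝ E (e x)) x := fun x hx =>
    (S.hasDerivAt (v x)).comp_hasFDerivAt x (hv x hx)
  have hv1 : ContDiffAt ℝ 1 v x₀ := by
    rw [show (1 : WithTop ℕ∞) = ((0 : ℕ) : WithTop ℕ∞) + 1 by simp,
      contDiffAt_succ_iff_hasFDerivAt]
    refine ⟨fun x => InnerProductSpace.toDual ℝ E (e x), ⟨_, ball_mem_nhds x₀ hρ0, hv⟩, ?_⟩
    rw [Nat.cast_zero, contDiffAt_zero]
    exact ⟨_, ball_mem_nhds x₀ hρ0,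
      (InnerProductSpace.toDual ℝ E).continuous.comp_continuousOn heL.continuousOn⟩
  have hq1 : ContDiff ℝ 1 q := by
    rw [contDiff_one_iff_deriv]
    refine ⟨fun t => (hqd t).differentiableAt, ?_⟩
    rw [funext fun t => (hqd t).deriv]
    exact (hqc.mul hHc).neg
  have hh1 : ContDiffAt ℝ 1 h (v x₀) := by
    rw [show (1 : WithTop ℕ∞) = ((0 : ℕ) : WithTop ℕ∞) + 1 by simp,
      contDiffAt_succ_iff_hasFDerivAt]
    refine ⟨_, ⟨_, ball_mem_nhds (v x₀) hρ0, fun σ hσ => (hh σ hσ).hasFDerivAt⟩, ?_⟩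
    rw [Nat.cast_zero, contDiffAt_zero]
    refine ⟨univ, univ_mem, Continuous.continuousOn ?_⟩
    have h1 : Continuous fun σ => k σ - h σ * H σ :=
      S.continuous_k.sub (S.continuous_h.mul hHc)
    exact (ContinuousLinearMap.toSpanSingletonCLE (𝕜 := ℝ) (E := ℝ)).continuous.comp h1
  refine ⟨?_, ?_⟩
  · rw [show (2 : WithTop ℕ∞) = ((1 : ℕ) : WithTop ℕ∞) + 1 by norm_num,
      contDiffAt_succ_iff_hasFDerivAt]
    refine ⟨fun x => (h (v x) / q (v x)) • fderiv ℝ (fun z => P (v z)) x,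
      ⟨_, ball_mem_nhds x₀ hρ0, fun x hx => ?_⟩, ?_⟩
    · refine (hud x hx).congr_fderiv ?_
      beta_reduce
      rw [(hwd x hx).fderiv, smul_smul, div_mul_cancel₀ _ (hq0 _).ne']
    · rw [Nat.cast_one]
      have h1 : ContDiffAt ℝ 1 (fderiv ℝ fun z => P (v z)) x₀ :=
        hw.fderiv_right (m := 1) (by norm_num; exact WithTop.coe_le_coe.2 le_top)
      exact ((hh1.comp x₀ hv1).div (hq1.contDiffAt.comp x₀ hv1) (hq0 _).ne').smul h1
  · rw [gradient, (hud x₀ hx₀).fderiv, LinearIsometryEquiv.norm_map, norm_smul,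
      LinearIsometryEquiv.norm_map, F.norm_eq x₀ (hsub1 hx₀), mul_one,
      Real.norm_of_nonneg (S.h_pos _).le]

end Regularity

/-! ### Normalization of the eikonal equation -/

section ChangeOfVariable

/-- A primitive of `1 / f`, for a bounded positive continuous `f`, and its inverse function. -/
theorem exists_primitive_inverse {f : ℝ → ℝ} (hf : Continuous f) (hpos : ∀ t, 0 < f t) {C : ℝ}
    (hC : ∀ t, f t ≤ C) :
    ∃ F G : ℝ → ℝ, (∀ t, G (F t) = t) ∧ (∀ s, HasDerivAt G (f (G s)) s) ∧ Continuous F := by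
  have hC0 : 0 < C := (hpos 0).trans_le (hC 0)
  have hinv : Continuous fun t => (f t)⁻¹ := hf.inv₀ fun t => (hpos t).ne'
  set F : ℝ → ℝ := fun t => ∫ s in (0 : ℝ)..t, (f s)⁻¹ with hF
  have hFd : ∀ t, HasDerivAt F (f t)⁻¹ t := fun t => hasDerivAt_integral hinv _ t
  have hFc : Continuous F := continuous_iff_continuousAt.2 fun t => (hFd t).continuousAt
  have hFmono : StrictMono F := strictMono_of_hasDerivAt_pos hFd fun t => inv_pos.2 (hpos t)
  have hF0 : F 0 = 0 := by simp [hF]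
  have hlin : Monotone fun t => F t - C⁻¹ * t := by
    refine monotone_of_hasDerivAt_nonneg (f' := fun t => (f t)⁻¹ - C⁻¹)
      (fun t => by
        have := (hFd t).sub ((hasDerivAt_id t).const_mul C⁻¹)
        rwa [mul_one] at this) fun t => ?_
    simp only [Pi.zero_apply, sub_nonneg]
    exact inv_anti₀ (hpos t) (hC t)
  have hsurj : Function.Surjective F := by
    refine hFc.surjective ?_ ?_
    · refine tendsto_atTop_mono' atTop ?_ (tendsto_id.const_mul_atTop (inv_pos.2 hC0))
      filter_upwards [eventually_ge_atTop 0] with t ht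
      have := hlin ht
      simp only [hF0, mul_zero, sub_zero] at this
      simp only [id]
      linarith
    · refine tendsto_atBot_mono' atBot ?_ (tendsto_id.const_mul_atBot (inv_pos.2 hC0))
      filter_upwards [eventually_le_atBot 0] with t ht
      have := hlin ht
      simp only [hF0, mul_zero, sub_zero] at this
      simp only [id]
      linarith
  let Φ := hFmono.orderIsoOfSurjective F hsurj
  have hΦ : ∀ t, Φ t = F t := fun t => rfl
  refine ⟨F, Φ.symm, fun t => by rw [← hΦ, Φ.symm_apply_apply], fun s => ?_, hFc⟩
  have := HasDerivAt.of_local_left_inverse (f := F) (a := s) Φ.symm.continuous.continuousAt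
    (hFd (Φ.symm s)) (inv_pos.2 (hpos _)).ne'
    (Eventually.of_forall fun y => by rw [← hΦ, Φ.apply_symm_apply])
  rwa [inv_inv] at this

end ChangeOfVariable

/-! ### Orientation of the eikonal equation -/

section Main

variable {n : ℕ}

/-- `u` is a viscosity solution in `Ω` of `|∇u| = f(u)` and `Δu = g(u)`, with the orientation of the
eikonal equation in which test functions touching from above have gradients of norm at most
`f(u)`. -/
structure IsOrientedSolution (f g : ℝ → ℝ) (Ω : Set (EuclideanSpace ℝ (Fin n)))
    (u : EuclideanSpace ℝ (Fin n) → ℝ) : Prop where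
  continuousOn : ContinuousOn u Ω
  above : ∀ x ∈ Ω, ∀ φ, TouchesFromAbove φ u x →
    ‖gradient φ x‖ ≤ f (u x) ∧ g (u x) ≤ (hessianMatrix φ x).trace
  below : ∀ x ∈ Ω, ∀ φ, TouchesFromBelow φ u x →
    f (u x) ≤ ‖gradient φ x‖ ∧ (hessianMatrix φ x).trace ≤ g (u x)

variable {f g : ℝ → ℝ} {Ω : Set (EuclideanSpace ℝ (Fin n))} {u : EuclideanSpace ℝ (Fin n) → ℝ}

theorem norm_gradient_neg (φ : EuclideanSpace ℝ (Fin n) → ℝ) (x : EuclideanSpace ℝ (Fin n)) :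
    ‖gradient (fun z => -φ z) x‖ = ‖gradient φ x‖ := by
  simp only [gradient, LinearIsometryEquiv.norm_map, fderiv_fun_neg, norm_neg]

theorem trace_hessianMatrix_neg (φ : EuclideanSpace ℝ (Fin n) → ℝ)
    (x : EuclideanSpace ℝ (Fin n)) :
    (hessianMatrix (fun z => -φ z) x).trace = -(hessianMatrix φ x).trace := by
  have h : fderiv ℝ (fun z => -φ z) = fun z => -fderiv ℝ φ z := funext fun z => fderiv_fun_neg
  simp [trace_hessianMatrix, h, fderiv_fun_neg]

theorem touchesFromBelow_neg {φ : EuclideanSpace ℝ (Fin n) → ℝ} {x : EuclideanSpace ℝ (Fin n)}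
    (h : TouchesFromAbove φ (fun z => -u z) x) : TouchesFromBelow (fun z => -φ z) u x :=
  ⟨h.1.neg, by simp [h.2.1], h.2.2.mono fun z hz => by linarith⟩

theorem touchesFromAbove_neg {φ : EuclideanSpace ℝ (Fin n) → ℝ} {x : EuclideanSpace ℝ (Fin n)}
    (h : TouchesFromBelow φ (fun z => -u z) x) : TouchesFromAbove (fun z => -φ z) u x :=
  ⟨h.1.neg, by simp [h.2.1], h.2.2.mono fun z hz => by linarith⟩

namespace IsOrientedSolution

/-- The bound on the gradients of `C²` test functions extends to all supergradients, because these are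
approximated by gradients of test functions at nearby points. -/
theorem norm_le_of_isSupergradientAt (S : IsOrientedSolution f g Ω u) (hf : Continuous f)
    (hΩ : IsOpen Ω) {x p : EuclideanSpace ℝ (Fin n)} (hx : x ∈ Ω) (hp : IsSupergradientAt u p x) :
    ‖p‖ ≤ f (u x) := by
  have hc : ContinuousAt (fun z => f (u z)) x :=
    hf.continuousAt.comp (S.continuousOn.continuousAt (hΩ.mem_nhds hx))
  refine le_of_forall_pos_le_add fun δ hδ => ?_
  obtain ⟨ε, hε, hball⟩ := Metric.mem_nhds_iff.1 (Filter.inter_mem (hΩ.mem_nhds hx)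
    (hc.eventually (gt_mem_nhds (show f (u x) < f (u x) + δ / 2 by linarith))))
  obtain ⟨y, q, ψ, hy, hq, hψ, hgr, hψy, hle⟩ := hp.exists_quadPoly (hΩ.mem_nhds hx)
    S.continuousOn (lt_min hε (half_pos hδ))
  have hyb := hball (mem_ball.2 (hy.trans_le (min_le_left _ _)))
  have h1 := (S.above y hyb.1 ψ ⟨hψ.contDiffAt, hψy, hle⟩).1
  rw [hgr.gradient] at h1
  have h2 : f (u y) < f (u x) + δ / 2 := hyb.2
  have h3 : ‖p‖ ≤ ‖q‖ + ‖q - p‖ := norm_le_insert q p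
  have h4 := hq.trans_le (min_le_right _ _)
  linarith

/-- The counterpart of `IsOrientedSolution.norm_le_of_isSupergradientAt` for subgradients. -/
theorem le_norm_of_isSupergradientAt_neg (S : IsOrientedSolution f g Ω u) (hf : Continuous f)
    (hΩ : IsOpen Ω) {x p : EuclideanSpace ℝ (Fin n)} (hx : x ∈ Ω)
    (hp : IsSupergradientAt (fun z => -u z) p x) : f (u x) ≤ ‖p‖ := by
  have hc : ContinuousAt (fun z => f (u z)) x :=
    hf.continuousAt.comp (S.continuousOn.continuousAt (hΩ.mem_nhds hx))
  refine le_of_forall_pos_le_add fun δ hδ => ?_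
  obtain ⟨ε, hε, hball⟩ := Metric.mem_nhds_iff.1 (Filter.inter_mem (hΩ.mem_nhds hx)
    (hc.eventually (lt_mem_nhds (show f (u x) - δ / 2 < f (u x) by linarith))))
  obtain ⟨y, q, ψ, hy, hq, hψ, hgr, hψy, hle⟩ := hp.exists_quadPoly (hΩ.mem_nhds hx)
    S.continuousOn.neg (lt_min hε (half_pos hδ))
  have hyb := hball (mem_ball.2 (hy.trans_le (min_le_left _ _)))
  have h1 := (S.below y hyb.1 _ (touchesFromBelow_neg ⟨hψ.contDiffAt, hψy, hle⟩)).1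
  rw [norm_gradient_neg, hgr.gradient] at h1
  have h2 : f (u x) - δ / 2 < f (u y) := hyb.2
  have h3 : ‖q‖ ≤ ‖p‖ + ‖q - p‖ := norm_le_insert' q p
  have h4 := hq.trans_le (min_le_right _ _)
  linarith

/-- If `F` is a primitive of `1 / f` and `G` its inverse, the function `v = F ∘ u` satisfies the
eikonal equation `|∇ v| = 1`, while `u = G ∘ v` retains its second order equation. -/
theorem isNormalizedSolution (S : IsOrientedSolution f g Ω u) (hf : Continuous f)
    (hpos : ∀ t, 0 < f t) (hg : Continuous g) {x₀ : EuclideanSpace ℝ (Fin n)} {R : ℝ}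
    (hsub : ball x₀ R ⊆ Ω) (hΩ : IsOpen Ω) {F G : ℝ → ℝ} (hFG : ∀ t, G (F t) = t)
    (hG : ∀ s, HasDerivAt G (f (G s)) s) (hF : Continuous F) :
    IsNormalizedSolution G (fun s => f (G s)) (fun s => g (G s)) (fun z => F (u z)) x₀ R := by
  have hGc : Continuous G := continuous_iff_continuousAt.2 fun s => (hG s).continuousAt
  have hGm : Monotone G := (strictMono_of_hasDerivAt_pos hG fun s => hpos _).monotone
  refine ⟨hG, hf.comp hGc, fun t => hpos _, hg.comp hGc,
    hF.comp_continuousOn (S.continuousOn.mono hsub), ?_, ?_, ?_, ?_⟩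
  · rintro x hx p ⟨φ, hφ, hφx, hle⟩
    have h1 := S.norm_le_of_isSupergradientAt hf hΩ (hsub hx) (p := f (u x) • p)
      ⟨fun z => G (φ z), ?_, by beta_reduce; rw [hφx, hFG], ?_⟩
    · rw [norm_smul, Real.norm_of_nonneg (hpos _).le] at h1
      exact le_of_mul_le_mul_left (by linarith) (hpos (u x))
    · rw [hasGradientAt_iff_hasFDerivAt] at hφ ⊢
      refine ((hG (φ x)).comp_hasFDerivAt x hφ).congr_fderiv ?_
      rw [hφx, hFG]
      simp
    · filter_upwards [hle] with z hz
      have := hGm hz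
      rwa [hFG] at this
  · rintro x hx p ⟨φ, hφ, hφx, hle⟩
    have h1 := S.le_norm_of_isSupergradientAt_neg hf hΩ (hsub hx) (p := f (u x) • p)
      ⟨fun z => -G (-φ z), ?_, by beta_reduce; rw [hφx, neg_neg, hFG], ?_⟩
    · rw [norm_smul, Real.norm_of_nonneg (hpos _).le] at h1
      exact le_of_mul_le_mul_left (by linarith) (hpos (u x))
    · rw [hasGradientAt_iff_hasFDerivAt] at hφ ⊢
      refine ((hG (-φ x)).comp_hasFDerivAt x hφ.neg).neg.congr_fderiv ?_
      rw [hφx, neg_neg, hFG]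
      simp
    · filter_upwards [hle] with z hz
      have := hGm (neg_le_neg hz)
      rw [neg_neg, hFG] at this
      linarith
  · intro x hx p B hB
    simp only [hFG] at hB ⊢
    exact hB.le_opTrace fun φ hφ => (S.above x (hsub hx) φ hφ).2
  · intro x hx p B hB
    simp only [hFG] at hB ⊢
    refine hB.le_opTrace fun φ hφ => ?_
    have := (S.below x (hsub hx) _ (touchesFromBelow_neg hφ)).2
    rw [trace_hessianMatrix_neg] at this
    linarith

/-- Regularity of oriented solutions. On a ball, `f` and `g` only matter on the compact interval of
values of `u`, so they may be taken to be defined and continuous on the whole line. -/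
theorem contDiffAt (S : IsOrientedSolution f g Ω u) (hΩ : IsOpen Ω)
    (hf : ContinuousOn f (u '' Ω)) (hpos : ∀ t ∈ u '' Ω, 0 < f t)
    (hg : ContinuousOn g (u '' Ω)) {x₀ : EuclideanSpace ℝ (Fin n)} (hx₀ : x₀ ∈ Ω) :
    ContDiffAt ℝ 2 u x₀ ∧ ‖gradient u x₀‖ = f (u x₀) := by
  obtain ⟨R, hR, hball⟩ := Metric.nhds_basis_closedBall.mem_iff.1 (hΩ.mem_nhds hx₀)
  have hcomp : IsCompact (u '' closedBall x₀ R) :=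
    (isCompact_closedBall x₀ R).image_of_continuousOn (S.continuousOn.mono hball)
  have hconn : IsConnected (u '' closedBall x₀ R) :=
    ((convex_closedBall x₀ R).isConnected ⟨x₀, mem_closedBall_self hR.le⟩).image u
      (S.continuousOn.mono hball)
  obtain ⟨a, b, hab, himg⟩ : ∃ a b, a ≤ b ∧ u '' closedBall x₀ R = Icc a b := by
    have h := eq_Icc_of_connected_compact hconn hcomp
    refine ⟨_, _, ?_, h⟩
    rw [← nonempty_Icc, ← h]
    exact hconn.nonempty
  have hsubI : Icc a b ⊆ u '' Ω := by
    rw [← himg]; exact image_mono hball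
  -- continuous extensions of the nonlinearities, constant outside the range of `u` on the ball
  set f' : ℝ → ℝ := IccExtend hab ((Icc a b).domRestrict f) with hf'
  set g' : ℝ → ℝ := IccExtend hab ((Icc a b).domRestrict g) with hg'
  have hf'c : Continuous f' := (hf.mono hsubI).domRestrict.Icc_extend'
  have hg'c : Continuous g' := (hg.mono hsubI).domRestrict.Icc_extend'
  have hf'pos : ∀ t, 0 < f' t := fun t => hpos _ (hsubI (projIcc a b hab t).2)
  obtain ⟨C, hC⟩ := isCompact_Icc.exists_bound_of_continuousOn (hf.mono hsubI)
  have hf'C : ∀ t, f' t ≤ C := fun t => (le_abs_self _).trans (hC _ (projIcc a b hab t).2)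
  have humem : ∀ x ∈ ball x₀ R, u x ∈ Icc a b := fun x hx => by
    rw [← himg]; exact mem_image_of_mem u (ball_subset_closedBall hx)
  have hff' : ∀ x ∈ ball x₀ R, f' (u x) = f (u x) := fun x hx => by
    rw [hf', IccExtend_of_mem hab _ (humem x hx), domRestrict_apply]
  have hgg' : ∀ x ∈ ball x₀ R, g' (u x) = g (u x) := fun x hx => by
    rw [hg', IccExtend_of_mem hab _ (humem x hx), domRestrict_apply]
  have hbΩ : ball x₀ R ⊆ Ω := ball_subset_closedBall.trans hball
  have S' : IsOrientedSolution f' g' (ball x₀ R) u := by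
    refine ⟨S.continuousOn.mono hbΩ, fun x hx φ hφ => ?_, fun x hx φ hφ => ?_⟩
    · rw [hff' x hx, hgg' x hx]; exact S.above x (hbΩ hx) φ hφ
    · rw [hff' x hx, hgg' x hx]; exact S.below x (hbΩ hx) φ hφ
  obtain ⟨F, G, hFG, hG, hF⟩ := exists_primitive_inverse hf'c hf'pos hf'C
  have hN := S'.isNormalizedSolution hf'c hf'pos hg'c (x₀ := x₀) (R := 12 * (R / 12))
    (by rw [mul_div_cancel₀ R (by norm_num : (12 : ℝ) ≠ 0)]) isOpen_ball hFG hG hF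
  have := hN.contDiffAt (by positivity)
  simp only [hFG] at this
  rwa [hff' x₀ (mem_ball_self hR)] at this

end IsOrientedSolution

/-- Where `g(u) < 0`, the negative of a viscosity solution of the system is an oriented solution. -/
theorem isOrientedSolution_neg (hu : IsViscositySolutionOfSystem f g Ω u) :
    IsOrientedSolution (fun t => f (-t)) (fun t => -g (-t)) {x ∈ Ω | g (u x) < 0}
      (fun z => -u z) := by
  refine ⟨(hu.1.continuousOn.mono (sep_subset _ _)).neg, ?_, ?_⟩
  · rintro x ⟨hx, hgx⟩ φ hφ
    have ht := touchesFromBelow_neg hφ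
    have h1 := hu.1.supersolution x hx _ ht
    have h2 := hu.2.supersolution x hx _ ht
    simp only [ht.2.1, visSgn, if_neg hgx.not_ge, norm_gradient_neg,
      trace_hessianMatrix_neg] at h1 h2
    simp only [neg_neg]
    constructor <;> linarith
  · rintro x ⟨hx, hgx⟩ φ hφ
    have ht := touchesFromAbove_neg hφ
    have h1 := hu.1.subsolution x hx _ ht
    have h2 := hu.2.subsolution x hx _ ht
    simp only [ht.2.1, visSgn, if_neg hgx.not_ge, norm_gradient_neg,
      trace_hessianMatrix_neg] at h1 h2
    simp only [neg_neg]
    constructor <;> linarith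

theorem gradient_eq_of_isLocalMax_sub {φ ψ : EuclideanSpace ℝ (Fin n) → ℝ}
    {x : EuclideanSpace ℝ (Fin n)} (hφ : DifferentiableAt ℝ φ x) (hψ : DifferentiableAt ℝ ψ x)
    (h : IsLocalMax (fun z => φ z - ψ z) x) : gradient φ x = gradient ψ x := by
  have := h.fderiv_eq_zero
  rw [fderiv_fun_sub hφ hψ, sub_eq_zero] at this
  simp only [gradient, this]

/-- A viscosity solution of the system is an oriented solution in all of `Ω`: the wrong orientation
where `g(u) < 0` does not matter, because `u` is of class `C²` there and the gradient of any test
function agrees with that of `u`. -/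
theorem isOrientedSolution (hΩ : IsOpen Ω) (hf : ContinuousOn f (u '' Ω))
    (hpos : ∀ t ∈ u '' Ω, 0 < f t) (hg : ContinuousOn g (u '' Ω))
    (hu : IsViscositySolutionOfSystem f g Ω u) : IsOrientedSolution f g Ω u := by
  have hcont := hu.1.continuousOn
  set Ω' := {x ∈ Ω | g (u x) < 0} with hΩ'
  have hopen : IsOpen Ω' :=
    (hg.comp hcont (mapsTo_image u Ω)).isOpen_inter_preimage hΩ isOpen_Iio
  have hmaps : ∀ t ∈ (fun z => -u z) '' Ω', -t ∈ u '' Ω := by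
    rintro _ ⟨x, hx, rfl⟩
    simpa using mem_image_of_mem u hx.1
  have hreg : ∀ x ∈ Ω', DifferentiableAt ℝ u x ∧ ‖gradient u x‖ = f (u x) := by
    intro x hx
    obtain ⟨h1, h2⟩ := (isOrientedSolution_neg hu).contDiffAt hopen
      (hf.comp continuous_neg.continuousOn hmaps) (fun t ht => hpos _ (hmaps t ht))
      ((hg.comp continuous_neg.continuousOn hmaps).neg) hx
    refine ⟨?_, by simpa [norm_gradient_neg] using h2⟩
    simpa using (h1.differentiableAt (by simp)).fun_neg
  refine ⟨hcont, fun x hx φ hφ => ?_, fun x hx φ hφ => ?_⟩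
  · have h1 := hu.1.subsolution x hx φ hφ
    have h2 := hu.2.subsolution x hx φ hφ
    simp only [hφ.2.1, visSgn] at h1 h2
    refine ⟨?_, by linarith⟩
    by_cases hgx : 0 ≤ g (u x)
    · rw [if_pos hgx] at h1
      linarith
    · obtain ⟨hd, hn⟩ := hreg x ⟨hx, not_le.1 hgx⟩
      rw [← gradient_eq_of_isLocalMax_sub hd (hφ.1.differentiableAt (by simp)) ?_, hn]
      filter_upwards [hφ.2.2] with z hz
      rw [hφ.2.1]
      linarith
  · have h1 := hu.1.supersolution x hx φ hφ
    have h2 := hu.2.supersolution x hx φ hφ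
    simp only [hφ.2.1, visSgn] at h1 h2
    refine ⟨?_, by linarith⟩
    by_cases hgx : 0 ≤ g (u x)
    · rw [if_pos hgx] at h1
      linarith
    · obtain ⟨hd, hn⟩ := hreg x ⟨hx, not_le.1 hgx⟩
      rw [gradient_eq_of_isLocalMax_sub (hφ.1.differentiableAt (by simp)) hd ?_, hn]
      filter_upwards [hφ.2.2] with z hz
      rw [hφ.2.1]
      linarith

theorem laplacian_eq_trace_hessianMatrix (φ : EuclideanSpace ℝ (Fin n) → ℝ)
    (x : EuclideanSpace ℝ (Fin n)) : Laplacian.laplacian φ x = (hessianMatrix φ x).trace := by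
  rw [InnerProductSpace.laplacian_eq_iteratedFDeriv_orthonormalBasis φ
    (EuclideanSpace.basisFun (Fin n) ℝ)]
  simp [hessianMatrix, Matrix.trace]

end Main

end SegreViscosity

theorem mainTheorem2 (n : ℕ) (Ω : Set (EuclideanSpace ℝ (Fin n))) (hΩ : IsOpen Ω)
    (u : EuclideanSpace ℝ (Fin n) → ℝ) (f g : ℝ → ℝ)
    (hf : ContinuousOn f (u '' Ω)) (hf_pos : ∀ t ∈ u '' Ω, 0 < f t)
    (hg : ContinuousOn g (u '' Ω))
    (hu : IsViscositySolutionOfSystem f g Ω u) :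
    ContDiffOn ℝ 2 u Ω ∧
      ∀ x ∈ Ω, ‖gradient u x‖ = f (u x) ∧ Laplacian.laplacian u x = g (u x) := by
  have S := SegreViscosity.isOrientedSolution hΩ hf hf_pos hg hu
  refine ⟨fun x hx => (S.contDiffAt hΩ hf hf_pos hg hx).1.contDiffWithinAt, fun x hx => ?_⟩
  obtain ⟨hC, hn⟩ := S.contDiffAt hΩ hf hf_pos hg hx
  refine ⟨hn, ?_⟩
  -- `u` is now its own test function, from above and from below
  rw [SegreViscosity.laplacian_eq_trace_hessianMatrix]
  exact le_antisymm (S.below x hx u ⟨hC, rfl, Filter.Eventually.of_forall fun _ => le_rfl⟩).2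
    (S.above x hx u ⟨hC, rfl, Filter.Eventually.of_forall fun _ => le_rfl⟩).2
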